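/- **Continuity of $K_0$ (projective K-theory).** *Data.* Let $T$ be a group with neutral element $1$, let $(T_n)_{n\ge 0}$ be an increasing sequence of finite subgroups of $T$ with $T_0=\{1\}$ and $\bigcup_n T_n=T$, let $E$ be a unital commutative C*-algebra with unitary group $U(E)$, and let $f:T\times T\to U(E)$ be a Schur $E$-function, i.e. $f(1,1)=1_E$ and $f(r,s)f(rs,t)=f(r,st)f(s,t)$ for all $r,s,t\in T$. An *$E$-C\*-algebra* is a (not necessarily unital) C*-algebra $F$ with a bilinear map $E\times F\to F$, $(\alpha,x)\mapsto\alpha x$, such that $(\alpha\beta)x=\alpha(\beta x)$, $1_Ex=x$, $\alpha(xy)=(\alpha x)y=x(\alpha y)$, $(\alpha x)^*=\alpha^*x^*$ and $\|\alpha x\|\le\|\alpha\|\,\|x\|$. Let $\mathfrak M_E$ be the category of $E$-C*-algebras with the $E$-linear $*$-homomorphisms. A *full $E$-C\*-algebra* is a unital C*-algebra containing $E$ as a unital C*-subalgebra whose elements commute with all of $F$; its morphisms are the unital $E$-linear $*$-homomorphisms. For a full $E$-C*-algebra $F$ and $n\ge0$ let $$F_n=\Big\{\sum_{t\in T_n}(X_t\otimes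 \mathrm{id})V_t\;:\;(X_t)_{t\in T_n}\in F^{T_n}\Big\},$$ an involutive algebra of adjointable operators on the right Hilbert $F$-module $F^{T_n}$, where, for $\xi\in F^{T_n}$ and $s\in T_n$, $(V_t\xi)(s)=f(t,t^{-1}s)\,\xi(t^{-1}s)$ and $((x\otimes \mathrm{id})\xi)(s)=x\,\xi(s)$. For $n\ge1$ one has $F_{n-1}\subseteq F_n$ (extend the family $(X_t)$ by $0$) and $E_n\subseteq F_n$. A unital $E$-linear $*$-homomorphism $\varphi:F\to G$ induces $\varphi_n:F_n\to G_n$, $\sum_t(X_t\otimes \mathrm{id})V_t\mapsto\sum_t(\varphi(X_t)\otimes \mathrm{id})V_t$. Fix $C_n\in E_n$ ($n\ge1$) such that $A_n:=C_n^*C_n$ and $B_n:=C_nC_n^*$ are projections, $A_n+B_n=1$, and $C_n$ commutes with every element of $E_{n-1}$. *The functor $K_0$.* For a full $E$-C*-algebra $F$, let $F_\to$ be the algebraic inductive limit of the involutive algebras $F_n$ along the maps $F_{n-1}\to F_n$, $X\mapsto A_nX$ (these are $*$-homomorphisms). Two projections $P,Q\in F_\to$ are equivalent if $X^*X=P$ and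 $XX^*=Q$ for some $X\in F_\to$. Any two projections are equivalent to orthogonal ones, and $[P]+[Q]:=[P'+Q']$ for orthogonal projections $P',Q'$ equivalent to $P,Q$ makes the set of equivalence classes a commutative monoid. $K_0^{\mathrm{full}}(F)$ is its Grothendieck group. A unital $E$-linear $*$-homomorphism $\varphi:F\to G$ induces, through the maps $\varphi_n$, a homomorphism $K_0^{\mathrm{full}}(\varphi):K_0^{\mathrm{full}}(F)\to K_0^{\mathrm{full}}(G)$. For an arbitrary $E$-C*-algebra $F$ let $\check F=E\times F$ be the full $E$-C*-algebra with coordinatewise linear operations and involution and with product $(\alpha,x)(\beta,y)=(\alpha\beta,\alpha y+\beta x+xy)$, and let $\pi^F:\check F\to E$, $(\alpha,x)\mapsto\alpha$. Put $$K_0(F):=\ker\big(K_0^{\mathrm{full}}(\pi^F):K_0^{\mathrm{full}}(\check F)\to K_0^{\mathrm{full}}(E)\big).$$ For an $E$-linear $*$-homomorphism $\varphi:F\to G$ let $\check\varphi(\alpha,x)=(\alpha,\varphi(x))$, and let $K_0(\varphi):K_0(F)\to K_0(G)$ be the restriction of $K_0^{\mathrm{full}}(\check\varphi)$. **Theorem.**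 Let $I$ be a nonempty upward directed preordered set, let $\big((F_i)_{i\in I},(\varphi_{ij}:F_i\to F_j)_{i\le j}\big)$ be an inductive system in $\mathfrak M_E$, and let $\big(F,(\varphi_i:F_i\to F)_{i\in I}\big)$ be its inductive limit in $\mathfrak M_E$. Then $\big((K_0(F_i))_{i\in I},(K_0(\varphi_{ij}))_{i\le j}\big)$ is an inductive system of abelian groups. Let $\big(\mathcal G,(\psi_i)_{i\in I}\big)$ be its inductive limit in the category of abelian groups. There is exactly one group homomorphism $\psi:\mathcal G\to K_0(F)$ with $\psi\circ\psi_i=K_0(\varphi_i)$ for every $i\in I$, and $\psi$ is an isomorphism. -/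

import Mathlib

set_option linter.unusedSectionVars false

namespace ProjK

/-! ### The Murray-von Neumann semigroup of an involutive ring -/

section MurrayVonNeumann

variable {R : Type*} [NonUnitalRing R] [StarRing R]

/-- The projections of an involutive ring. -/
abbrev Proj (R : Type*) [NonUnitalRing R] [StarRing R] : Type _ := {p : R // IsStarProjection p}

/-- Murray-von Neumann equivalence of projections. -/
def MvN (p q : Proj R) : Prop := ∃ x : R, star x * x = p ∧ x * star x = q

theorem Proj.mul_self (p : Proj R) : (p : R) * p = p := p.2.isIdempotentElem.eq

theorem Proj.star_self (p : Proj R) : star (p : R) = p := p.2.isSelfAdjoint.star_eq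

theorem MvN.exists_partialIsometry {p q : Proj R} (h : MvN p q) :
    ∃ x : R, star x * x = p ∧ x * star x = q ∧ x * p = x ∧ q * x = x := by
  obtain ⟨x, h1, h2⟩ := h
  refine ⟨x * p, ?_, ?_, ?_, ?_⟩
  · rw [star_mul, p.star_self, mul_assoc, ← mul_assoc (star x), h1, p.mul_self, p.mul_self]
  · rw [star_mul, p.star_self, mul_assoc, ← mul_assoc (p : R), p.mul_self, ← h1, mul_assoc, h2,
      ← mul_assoc, h2, q.mul_self]
  · rw [mul_assoc, p.mul_self]
  · rw [← h2, mul_assoc, ← mul_assoc (star x), h1, p.mul_self]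

theorem MvN.refl (p : Proj R) : MvN p p :=
  ⟨p, by rw [p.star_self, p.mul_self], by rw [p.star_self, p.mul_self]⟩

theorem MvN.symm {p q : Proj R} (h : MvN p q) : MvN q p := by
  obtain ⟨x, h1, h2⟩ := h
  exact ⟨star x, by rw [star_star, h2], by rw [star_star, h1]⟩

theorem MvN.trans {p q r : Proj R} (h : MvN p q) (h' : MvN q r) : MvN p r := by
  obtain ⟨x, h1, h2, h3, h4⟩ := h.exists_partialIsometry
  obtain ⟨y, k1, k2, k3, k4⟩ := h'.exists_partialIsometry
  refine ⟨y * x, ?_, ?_⟩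
  · rw [star_mul, mul_assoc, ← mul_assoc (star y), k1, h4, h1]
  · rw [star_mul, mul_assoc, ← mul_assoc x, h2, ← mul_assoc, k3, k2]

/-- Murray-von Neumann equivalence as an equivalence relation. -/
instance mvnSetoid (R : Type*) [NonUnitalRing R] [StarRing R] : Setoid (Proj R) where
  r := MvN
  iseqv := ⟨MvN.refl, MvN.symm, MvN.trans⟩

theorem Proj.mul_eq_zero_symm {p q : Proj R} (h : (p : R) * q = 0) : (q : R) * p = 0 := by
  have := congrArg star h
  rwa [star_mul, star_zero, p.star_self, q.star_self] at this

/-- The sum of two orthogonal projections. -/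
def Proj.add (p q : Proj R) (h : (p : R) * q = 0) : Proj R :=
  ⟨p + q, by
    refine ⟨?_, ?_⟩
    · change ((p : R) + q) * (p + q) = p + q
      rw [add_mul, mul_add, mul_add, h, Proj.mul_eq_zero_symm h, p.mul_self, q.mul_self, add_zero,
        zero_add]
    · change star ((p : R) + q) = p + q
      rw [star_add, p.star_self, q.star_self]⟩

theorem MvN.add {p q p' q' : Proj R} (hp : MvN p p') (hq : MvN q q') (h : (p : R) * q = 0)
    (h' : (p' : R) * q' = 0) : MvN (p.add q h) (p'.add q' h') := by
  obtain ⟨x, x1, x2, x3, x4⟩ := hp.exists_partialIsometry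
  obtain ⟨y, y1, y2, y3, y4⟩ := hq.exists_partialIsometry
  have e1 : star x * y = 0 := by
    rw [← x4, ← y4, star_mul, p'.star_self, mul_assoc, ← mul_assoc (p' : R), h', zero_mul, mul_zero]
  have e2 : star y * x = 0 := by simpa using congrArg star e1
  have e3 : x * star y = 0 := by
    rw [← x3, ← y3, star_mul, q.star_self, mul_assoc, ← mul_assoc (p : R), h, zero_mul, mul_zero]
  have e4 : y * star x = 0 := by simpa using congrArg star e3
  refine ⟨x + y, ?_, ?_⟩
  · change _ = (p : R) + q
    rw [star_add, add_mul, mul_add, mul_add, e1, e2, x1, y1, add_zero, zero_add]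
  · change _ = (p' : R) + q'
    rw [star_add, add_mul, mul_add, mul_add, e3, e4, x2, y2, add_zero, zero_add]

/-- Any two projections are equivalent to orthogonal ones. -/
class HasOrthogonalCopies (R : Type*) [NonUnitalRing R] [StarRing R] : Prop where
  exists_orthogonal : ∀ p q : Proj R, ∃ p' q' : Proj R, MvN p p' ∧ MvN q q' ∧ (p' : R) * q' = 0

/-- The set of equivalence classes of projections. -/
def ProjClass (R : Type*) [NonUnitalRing R] [StarRing R] : Type _ := Quotient (mvnSetoid R)

/-- The equivalence class of a projection. -/
def ProjClass.mk (p : Proj R) : ProjClass R := Quotient.mk (mvnSetoid R) p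

theorem ProjClass.sound {p q : Proj R} (h : MvN p q) : ProjClass.mk p = ProjClass.mk q :=
  Quotient.sound h

theorem ProjClass.exact {p q : Proj R} (h : ProjClass.mk p = ProjClass.mk q) : MvN p q :=
  Quotient.exact h

theorem ProjClass.exists_rep (a : ProjClass R) : ∃ p : Proj R, ProjClass.mk p = a :=
  Quotient.exists_rep a

namespace ProjClass

variable [HasOrthogonalCopies R]

/-- Addition of classes: `[p] + [q] = [p' + q']` for orthogonal projections `p'` and `q'` equivalent
to `p` and `q`. -/
noncomputable instance instAdd : Add (ProjClass R) where
  add := Quotient.map₂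
    (fun p q =>
      (HasOrthogonalCopies.exists_orthogonal p q).choose.add
        (HasOrthogonalCopies.exists_orthogonal p q).choose_spec.choose
        (HasOrthogonalCopies.exists_orthogonal p q).choose_spec.choose_spec.2.2)
    (fun p₁ p₂ hp q₁ q₂ hq => by
      have h₁ := (HasOrthogonalCopies.exists_orthogonal p₁ q₁).choose_spec.choose_spec
      have h₂ := (HasOrthogonalCopies.exists_orthogonal p₂ q₂).choose_spec.choose_spec
      exact MvN.add ((h₁.1.symm.trans hp).trans h₂.1) ((h₁.2.1.symm.trans hq).trans h₂.2.1) _ _)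

instance instZero : Zero (ProjClass R) where
  zero := mk ⟨0, IsStarProjection.zero R⟩

theorem mk_add_mk (p q : Proj R) (h : (p : R) * q = 0) : mk p + mk q = mk (p.add q h) := by
  have h₁ := (HasOrthogonalCopies.exists_orthogonal p q).choose_spec.choose_spec
  exact sound (MvN.add h₁.1.symm h₁.2.1.symm _ _)

theorem exists_orthogonal_reps (a b : ProjClass R) :
    ∃ (p q : Proj R), (p : R) * q = 0 ∧ mk p = a ∧ mk q = b := by
  obtain ⟨p, rfl⟩ := a.exists_rep
  obtain ⟨q, rfl⟩ := b.exists_rep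
  obtain ⟨p', q', hp, hq, h⟩ := HasOrthogonalCopies.exists_orthogonal p q
  exact ⟨p', q', h, sound hp.symm, sound hq.symm⟩

theorem exists_orthogonal_reps₃ (a b c : ProjClass R) :
    ∃ (p q r : Proj R), (p : R) * q = 0 ∧ (p : R) * r = 0 ∧ (q : R) * r = 0 ∧
      mk p = a ∧ mk q = b ∧ mk r = c := by
  obtain ⟨p, q, hpq, rfl, rfl⟩ := exists_orthogonal_reps a b
  obtain ⟨s, r, hsr, hs, rfl⟩ := exists_orthogonal_reps (mk (p.add q hpq)) c
  obtain ⟨x, h1, h2, h3, h4⟩ := (exact hs).symm.exists_partialIsometry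
  have hqp := Proj.mul_eq_zero_symm hpq
  have h1' : star x * x = (p : R) + q := h1
  have hxp : (star x * x) * p = p := by rw [h1', add_mul, p.mul_self, hqp, add_zero]
  have hxq : (star x * x) * q = q := by rw [h1', add_mul, q.mul_self, hpq, zero_add]
  have conj : ∀ e : Proj R, (star x * x) * e = e →
      ∃ e' : Proj R, MvN e e' ∧ (e' : R) = x * e * star x := by
    intro e he
    have ha : (x * e * star x) * (x * e * star x) = x * e * star x := by
      rw [mul_assoc, mul_assoc x, ← mul_assoc (star x) _, ← mul_assoc (star x), he,
        ← mul_assoc (e : R), e.mul_self, ← mul_assoc]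
    have hb : star (x * e * star x) = x * e * star x := by
      rw [star_mul, star_mul, star_star, e.star_self, mul_assoc]
    refine ⟨⟨x * e * star x, ha, hb⟩, ⟨x * e, ?_, ?_⟩, rfl⟩
    · rw [star_mul, e.star_self, mul_assoc, ← mul_assoc (star x), he, e.mul_self]
    · change _ = x * e * star x
      rw [star_mul, e.star_self, mul_assoc, ← mul_assoc (e : R), e.mul_self, ← mul_assoc]
  have hsx : star x * s = star x := by
    simpa [s.star_self] using congrArg star h4
  obtain ⟨p', hp', ep⟩ := conj p hxp
  obtain ⟨q', hq', eq⟩ := conj q hxq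
  refine ⟨p', q', r, ?_, ?_, ?_, sound hp'.symm, sound hq'.symm, rfl⟩
  · rw [ep, eq, mul_assoc, ← mul_assoc (star x), ← mul_assoc (star x), hxq, mul_assoc,
      ← mul_assoc (p : R), hpq, zero_mul, mul_zero]
  · rw [ep, ← hsx, mul_assoc, mul_assoc (star x), hsr, mul_zero, mul_zero]
  · rw [eq, ← hsx, mul_assoc, mul_assoc (star x), hsr, mul_zero, mul_zero]

noncomputable instance instAddCommMonoid : AddCommMonoid (ProjClass R) where
  add_assoc a b c := by
    obtain ⟨p, q, r, hpq, hpr, hqr, rfl, rfl, rfl⟩ := exists_orthogonal_reps₃ a b c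
    have h1 : ((p.add q hpq : Proj R) : R) * r = 0 := by
      change ((p : R) + q) * r = 0
      rw [add_mul, hpr, hqr, add_zero]
    have h2 : (p : R) * (q.add r hqr : Proj R) = 0 := by
      change (p : R) * (q + r) = 0
      rw [mul_add, hpq, hpr, add_zero]
    rw [mk_add_mk p q hpq, mk_add_mk q r hqr, mk_add_mk _ _ h1, mk_add_mk _ _ h2]
    exact congrArg mk (Subtype.ext (add_assoc _ _ _))
  zero_add a := by
    obtain ⟨p, rfl⟩ := a.exists_rep
    change mk ⟨0, IsStarProjection.zero R⟩ + mk p = mk p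
    rw [mk_add_mk _ _ (zero_mul _)]
    exact congrArg mk (Subtype.ext (zero_add _))
  add_zero a := by
    obtain ⟨p, rfl⟩ := a.exists_rep
    change mk p + mk ⟨0, IsStarProjection.zero R⟩ = mk p
    rw [mk_add_mk _ _ (mul_zero _)]
    exact congrArg mk (Subtype.ext (add_zero _))
  add_comm a b := by
    obtain ⟨p, q, h, rfl, rfl⟩ := exists_orthogonal_reps a b
    rw [mk_add_mk p q h, mk_add_mk q p (Proj.mul_eq_zero_symm h)]
    exact congrArg mk (Subtype.ext (add_comm _ _))
  nsmul := nsmulRec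

variable {R' : Type*} [NonUnitalRing R'] [StarRing R'] [HasOrthogonalCopies R']

/-- The image of a projection under a `*`-homomorphism. -/
def _root_.ProjK.Proj.map (φ : R →⋆ₙ+* R') (p : Proj R) : Proj R' :=
  ⟨φ p, by
    refine ⟨?_, ?_⟩
    · change φ p * φ p = φ p
      rw [← map_mul, p.mul_self]
    · change star (φ p) = φ p
      rw [← map_star, p.star_self]⟩

/-- The map of classes of projections induced by a `*`-homomorphism. -/
def map (φ : R →⋆ₙ+* R') : ProjClass R →+ ProjClass R' where
  toFun := Quotient.map (Proj.map φ) (by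
    rintro p q ⟨x, h1, h2⟩
    refine ⟨φ x, ?_, ?_⟩
    · rw [← map_star, ← map_mul, h1]; rfl
    · rw [← map_star, ← map_mul, h2]; rfl)
  map_zero' := congrArg mk (Subtype.ext (map_zero φ))
  map_add' a b := by
    obtain ⟨p, q, h, rfl, rfl⟩ := exists_orthogonal_reps a b
    have h' : ((Proj.map φ p : Proj R') : R') * (Proj.map φ q : Proj R') = 0 := by
      change φ p * φ q = 0
      rw [← map_mul, h, map_zero]
    rw [mk_add_mk p q h]
    refine Eq.trans ?_ (mk_add_mk _ _ h').symm
    exact congrArg mk (Subtype.ext (map_add φ _ _))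

theorem map_mk (φ : R →⋆ₙ+* R') (p : Proj R) : map φ (mk p) = mk (p.map φ) := rfl

end ProjClass

end MurrayVonNeumann

/-- A Schur `E`-function for the group `T`: a normalised two-cocycle with values in the unitary group
of `E`. -/
structure IsSchurFunction {T E : Type*} [Group T] [CommCStarAlgebra E] (f : T → T → unitary E) :
    Prop where
  one_one : f 1 1 = 1
  cocycle : ∀ r s t : T, f r s * f (r * s) t = f r (s * t) * f s t

/-- An increasing sequence of finite subgroups of `T` with union `T`, starting with the trivial
subgroup, together with a Schur `E`-function for `T`. -/
structure SchurSystem (T E : Type*) [Group T] [CommCStarAlgebra E] where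
  Tn : ℕ → Subgroup T
  Tn_zero : Tn 0 = ⊥
  mono : Monotone Tn
  finite : ∀ n, Finite (Tn n)
  exhaust : ∀ t : T, ∃ n, t ∈ Tn n
  f : T → T → unitary E
  schur : IsSchurFunction f

noncomputable section

namespace SchurSystem

variable {T E : Type*} [Group T] [CommCStarAlgebra E] (S : SchurSystem T E)

instance instFintypeTn (n : ℕ) : Fintype (S.Tn n) :=
  haveI := S.finite n
  Fintype.ofFinite _

instance instDecidableEqTn (n : ℕ) : DecidableEq (S.Tn n) := Classical.decEq _

theorem f_right_one (r : T) : S.f r 1 = 1 := by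
  have h := S.schur.cocycle r 1 1
  simpa [S.schur.one_one] using h

theorem f_left_one (t : T) : S.f 1 t = 1 := by
  have h := S.schur.cocycle 1 1 t
  simpa [S.schur.one_one] using h

section algebra

variable (A : Type*) [Ring A] [StarRing A] [Algebra E A] [StarModule E A]

/-- The operator `V_t` on `A^{T_n}`, `(V_t ξ)(s) = f(t, t⁻¹ s) ξ(t⁻¹ s)`, as a matrix. -/
def V (n : ℕ) (t : S.Tn n) : Matrix (S.Tn n) (S.Tn n) A :=
  Matrix.of fun s r =>
    if r = t⁻¹ * s then algebraMap E A (S.f (t : T) ((t⁻¹ * s : S.Tn n) : T)) else 0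

variable {A}

/-- The operator `∑_{t ∈ T_n} (X_t ⊗ id) V_t` on `A^{T_n}`, as a matrix; `x ⊗ id` is the
multiplication of every coordinate by `x` on the left. -/
def twist (n : ℕ) (X : S.Tn n → A) : Matrix (S.Tn n) (S.Tn n) A :=
  ∑ t : S.Tn n, Matrix.diagonal (fun _ => X t) * S.V A n t

theorem twist_apply (n : ℕ) (X : S.Tn n → A) (s r : S.Tn n) :
    S.twist n X s r = (S.f ((s : T) * (r : T)⁻¹) r : E) • X (s * r⁻¹) := by
  have key : ∀ t : S.Tn n, (Matrix.diagonal (fun _ => X t) * S.V A n t :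
      Matrix (S.Tn n) (S.Tn n) A) s r
      = if t = s * r⁻¹ then (S.f ((s : T) * (r : T)⁻¹) r : E) • X (s * r⁻¹) else 0 := by
    intro t
    rw [Matrix.diagonal_mul, V, Matrix.of_apply]
    by_cases h : t = s * r⁻¹
    · subst h
      have h1 : r = (s * r⁻¹)⁻¹ * s := by group
      rw [if_pos h1, if_pos rfl, ← h1, Algebra.smul_def, Algebra.commutes]
      simp
    · have h1 : ¬ r = t⁻¹ * s := by
        rintro rfl
        apply h
        group
      rw [if_neg h1, if_neg h, mul_zero]
  rw [twist, Matrix.sum_apply, Finset.sum_congr rfl (fun t _ => key t)]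
  simp

theorem twist_apply_one (n : ℕ) (X : S.Tn n → A) (t : S.Tn n) : S.twist n X t 1 = X t := by
  rw [twist_apply]
  simp [f_right_one]

theorem twist_injective (n : ℕ) : Function.Injective (S.twist n : (S.Tn n → A) → _) := by
  intro X Y h
  funext t
  rw [← S.twist_apply_one n X t, h, S.twist_apply_one]

/-- The product of two coefficient families. -/
def conv (n : ℕ) (X Y : S.Tn n → A) : S.Tn n → A := fun t =>
  ∑ u : S.Tn n, (S.f (u : T) ((u : T)⁻¹ * t) : E) • (X u * Y (u⁻¹ * t))

theorem twist_mul (n : ℕ) (X Y : S.Tn n → A) :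
    S.twist n X * S.twist n Y = S.twist n (S.conv n X Y) := by
  ext s r
  rw [Matrix.mul_apply, twist_apply, conv, Finset.smul_sum]
  refine Fintype.sum_equiv ((Equiv.inv (S.Tn n)).trans (Equiv.mulLeft s)) _ _ fun q => ?_
  have h1 : (s * q⁻¹)⁻¹ * (s * r⁻¹) = q * r⁻¹ := by group
  have hc := congrArg (fun z : unitary E => (z : E))
    (S.schur.cocycle ((s : T) * (q : T)⁻¹) ((q : T) * (r : T)⁻¹) r)
  simp only [Submonoid.coe_mul, mul_assoc, inv_mul_cancel, mul_one,
    inv_mul_cancel_left] at hc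
  simp only [twist_apply, Equiv.trans_apply, Equiv.inv_apply, Equiv.coe_mulLeft, h1]
  rw [smul_mul_smul_comm, smul_smul]
  congr 1
  have h2 : (((s * q⁻¹ : S.Tn n) : T))⁻¹ * ((s * r⁻¹ : S.Tn n) : T) = (q : T) * (r : T)⁻¹ := by
    push_cast; group
  rw [h2]
  push_cast
  rw [← hc, mul_comm]

/-- The adjoint of a coefficient family. -/
def adj (n : ℕ) (X : S.Tn n → A) : S.Tn n → A := fun t =>
  star (S.f ((t : T)⁻¹) (t : T) : E) • star (X t⁻¹)

theorem star_twist (n : ℕ) (X : S.Tn n → A) : star (S.twist n X) = S.twist n (S.adj n X) := by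
  ext s r
  rw [Matrix.star_apply, twist_apply, twist_apply, adj, star_smul, smul_smul]
  have h1 : (s * r⁻¹)⁻¹ = r * s⁻¹ := by group
  rw [h1]
  congr 1
  have hc := congrArg (fun z : unitary E => (z : E))
    (S.schur.cocycle ((r : T) * (s : T)⁻¹) ((s : T) * (r : T)⁻¹) r)
  have h2 : (r : T) * (s : T)⁻¹ * ((s : T) * (r : T)⁻¹) = 1 := by group
  have h3 : (s : T) * (r : T)⁻¹ * r = s := by group
  rw [h2, h3, f_left_one, mul_one] at hc
  have h4 : (((s * r⁻¹ : S.Tn n) : T))⁻¹ = (r : T) * (s : T)⁻¹ := by push_cast; group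
  rw [h4]
  push_cast at hc ⊢
  rw [hc, star_mul, ← mul_assoc, Unitary.mul_star_self_of_mem (S.f _ _).2, one_mul]


theorem twist_add (n : ℕ) (X Y : S.Tn n → A) :
    S.twist n X + S.twist n Y = S.twist n (X + Y) := by
  ext s r
  simp [twist_apply]

theorem smul_twist (n : ℕ) (c : E) (X : S.Tn n → A) :
    c • S.twist n X = S.twist n (c • X) := by
  ext s r
  simp [twist_apply, smul_smul, mul_comm]

theorem twist_single_one (n : ℕ) (a : A) :
    S.twist n (Pi.single 1 a) = Matrix.diagonal fun _ => a := by
  ext s r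
  rw [twist_apply]
  by_cases h : s = r
  · subst h
    simp [f_left_one]
  · rw [Pi.single_eq_of_ne (by simpa [mul_inv_eq_one] using h), smul_zero,
      Matrix.diagonal_apply_ne _ h]

variable (A)

/-- The `*`-algebra `A_n = {∑_{t ∈ T_n} (X_t ⊗ id) V_t}` of operators on `A^{T_n}`. -/
def algSub (n : ℕ) : StarSubalgebra E (Matrix (S.Tn n) (S.Tn n) A) where
  carrier := Set.range (S.twist n)
  mul_mem' := by
    rintro _ _ ⟨X, rfl⟩ ⟨Y, rfl⟩
    exact ⟨_, (S.twist_mul n X Y).symm⟩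
  add_mem' := by
    rintro _ _ ⟨X, rfl⟩ ⟨Y, rfl⟩
    exact ⟨_, (S.twist_add n X Y).symm⟩
  algebraMap_mem' := fun c => ⟨Pi.single 1 (algebraMap E A c), by
    rw [twist_single_one]; rfl⟩
  star_mem' := by
    rintro _ ⟨X, rfl⟩
    exact ⟨_, (S.star_twist n X).symm⟩

/-- The `*`-algebra `A_n`, as a type. -/
def Alg (n : ℕ) : Type _ := S.algSub A n

instance instRingAlg (n : ℕ) : Ring (S.Alg A n) := inferInstanceAs (Ring (S.algSub A n))

instance instStarRingAlg (n : ℕ) : StarRing (S.Alg A n) :=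
  inferInstanceAs (StarRing (S.algSub A n))

instance instAlgebraAlg (n : ℕ) : Algebra E (S.Alg A n) :=
  inferInstanceAs (Algebra E (S.algSub A n))

instance instStarModuleAlg (n : ℕ) : StarModule E (S.Alg A n) :=
  inferInstanceAs (StarModule E (S.algSub A n))

variable {A}

/-- The coefficients `X_t` of the element `∑_t (X_t ⊗ id) V_t`. -/
def coeff {n : ℕ} (M : S.Alg A n) : S.Tn n → A := fun t => M.1 t 1

/-- The element `∑_t (X_t ⊗ id) V_t` with given coefficients. -/
def ofCoeff (n : ℕ) (X : S.Tn n → A) : S.Alg A n := ⟨S.twist n X, X, rfl⟩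

theorem coeff_ofCoeff (n : ℕ) (X : S.Tn n → A) : S.coeff (S.ofCoeff n X) = X :=
  funext fun t => S.twist_apply_one n X t

theorem ofCoeff_coeff {n : ℕ} (M : S.Alg A n) : S.ofCoeff n (S.coeff M) = M := by
  obtain ⟨_, X, rfl⟩ := M
  exact congrArg (S.ofCoeff n) (S.coeff_ofCoeff n X)

theorem coeff_injective {n : ℕ} : Function.Injective (S.coeff : S.Alg A n → _) := fun M N h => by
  rw [← S.ofCoeff_coeff M, h, S.ofCoeff_coeff]

theorem coeff_mul {n : ℕ} (M N : S.Alg A n) :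
    S.coeff (M * N) = S.conv n (S.coeff M) (S.coeff N) := by
  have h : M * N = S.ofCoeff n (S.conv n (S.coeff M) (S.coeff N)) := by
    conv_lhs => rw [← S.ofCoeff_coeff M, ← S.ofCoeff_coeff N]
    exact Subtype.ext (S.twist_mul n _ _)
  rw [h, coeff_ofCoeff]

theorem coeff_star {n : ℕ} (M : S.Alg A n) : S.coeff (star M) = S.adj n (S.coeff M) := by
  have h : star M = S.ofCoeff n (S.adj n (S.coeff M)) := by
    conv_lhs => rw [← S.ofCoeff_coeff M]
    exact Subtype.ext (S.star_twist n _)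
  rw [h, coeff_ofCoeff]

theorem coeff_add {n : ℕ} (M N : S.Alg A n) : S.coeff (M + N) = S.coeff M + S.coeff N := rfl

theorem coeff_zero {n : ℕ} : S.coeff (0 : S.Alg A n) = 0 := rfl

theorem coeff_algebraMap {n : ℕ} (c : E) :
    S.coeff (algebraMap E (S.Alg A n) c) = Pi.single 1 (algebraMap E A c) := by
  have h : algebraMap E (S.Alg A n) c = S.ofCoeff n (Pi.single 1 (algebraMap E A c)) := by
    apply Subtype.ext
    change _ = S.twist n _
    rw [twist_single_one]
    rfl
  rw [h, coeff_ofCoeff]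

/-- Extension by zero of a family of coefficients from `T_n` to `T_{n+1}`. -/
def extend (n : ℕ) (X : S.Tn n → A) : S.Tn (n + 1) → A := fun t =>
  haveI := Classical.dec ((t : T) ∈ S.Tn n)
  if h : (t : T) ∈ S.Tn n then X ⟨t, h⟩ else 0

theorem extend_of_mem (n : ℕ) (X : S.Tn n → A) (t : S.Tn (n + 1)) (h : (t : T) ∈ S.Tn n) :
    S.extend n X t = X ⟨t, h⟩ := dif_pos h

theorem extend_of_notMem (n : ℕ) (X : S.Tn n → A) (t : S.Tn (n + 1)) (h : (t : T) ∉ S.Tn n) :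
    S.extend n X t = 0 := dif_neg h

theorem extend_conv (n : ℕ) (X Y : S.Tn n → A) :
    S.extend n (S.conv n X Y) = S.conv (n + 1) (S.extend n X) (S.extend n Y) := by
  funext t
  by_cases ht : (t : T) ∈ S.Tn n
  · rw [extend_of_mem _ _ _ _ ht, conv, conv]
    refine Fintype.sum_of_injective (fun u : S.Tn n => (⟨u, S.mono n.le_succ u.2⟩ : S.Tn (n + 1)))
      (fun u v h => Subtype.ext (congrArg (fun z : S.Tn (n + 1) => (z : T)) h)) _ _ ?_ ?_
    · intro u hu
      have hu' : (u : T) ∉ S.Tn n := fun h => hu ⟨⟨u, h⟩, rfl⟩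
      rw [extend_of_notMem _ _ _ _ hu', zero_mul, smul_zero]
    · intro u
      rw [extend_of_mem _ _ X _ u.2, extend_of_mem _ _ Y _ (mul_mem (inv_mem u.2) ht)]
      rfl
  · rw [extend_of_notMem _ _ _ _ ht, conv]
    symm
    refine Finset.sum_eq_zero fun u _ => ?_
    by_cases hu : (u : T) ∈ S.Tn n
    · have : ((u⁻¹ * t : S.Tn (n + 1)) : T) ∉ S.Tn n := fun h => ht (by
        simpa using mul_mem hu h)
      rw [extend_of_notMem _ _ Y _ this, mul_zero, smul_zero]
    · rw [extend_of_notMem _ _ X _ hu, zero_mul, smul_zero]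

theorem extend_adj (n : ℕ) (X : S.Tn n → A) :
    S.extend n (S.adj n X) = S.adj (n + 1) (S.extend n X) := by
  funext t
  by_cases ht : (t : T) ∈ S.Tn n
  · rw [extend_of_mem _ _ _ _ ht, adj, adj, extend_of_mem _ _ X _ (inv_mem ht)]
    rfl
  · rw [extend_of_notMem _ _ _ _ ht, adj, extend_of_notMem _ _ X _ (by simpa using ht)]
    simp

theorem extend_single (n : ℕ) (w : S.Tn n) (x : A) :
    S.extend n (Pi.single w x : S.Tn n → A) =
      (Pi.single ⟨w, S.mono n.le_succ w.2⟩ x : S.Tn (n + 1) → A) := by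
  funext t
  by_cases htw : t = ⟨w, S.mono n.le_succ w.2⟩
  · subst htw
    rw [S.extend_of_mem _ _ _ w.2, Pi.single_eq_same]
    exact (Pi.single_eq_same (M := fun _ : S.Tn (n + 1) => A) ⟨w, S.mono n.le_succ w.2⟩ x).symm
  · rw [Pi.single_eq_of_ne htw]
    by_cases ht : (t : T) ∈ S.Tn n
    · have hne : (⟨t, ht⟩ : S.Tn n) ≠ w := by
        rintro rfl
        exact htw rfl
      rw [S.extend_of_mem _ _ _ ht, Pi.single_eq_of_ne hne]
    · rw [S.extend_of_notMem _ _ _ ht]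

theorem extend_single_one (n : ℕ) (a : A) :
    S.extend n (Pi.single 1 a : S.Tn n → A) = (Pi.single 1 a : S.Tn (n + 1) → A) :=
  S.extend_single n 1 a

/-- The canonical unital inclusion `A_n ⊆ A_{n+1}`. -/
def incl (n : ℕ) : S.Alg A n →⋆ₐ[E] S.Alg A (n + 1) where
  toFun M := S.ofCoeff (n + 1) (S.extend n (S.coeff M))
  map_one' := S.coeff_injective (by
    rw [coeff_ofCoeff, ← map_one (algebraMap E (S.Alg A n)), coeff_algebraMap, extend_single_one,
      ← coeff_algebraMap, map_one])
  map_mul' M N := S.coeff_injective (by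
    rw [coeff_ofCoeff, coeff_mul, coeff_mul, coeff_ofCoeff, coeff_ofCoeff, extend_conv])
  map_zero' := S.coeff_injective (by
    rw [coeff_ofCoeff, coeff_zero, coeff_zero]
    funext t
    unfold extend
    split <;> rfl)
  map_add' M N := S.coeff_injective (by
    rw [coeff_ofCoeff, coeff_add, coeff_add, coeff_ofCoeff, coeff_ofCoeff]
    funext t
    simp only [Pi.add_apply]
    unfold extend
    split
    · rfl
    · rw [add_zero])
  commutes' c := S.coeff_injective (by
    rw [coeff_ofCoeff, coeff_algebraMap, extend_single_one, ← coeff_algebraMap])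
  map_star' M := S.coeff_injective (by
    rw [coeff_ofCoeff, coeff_star, coeff_star, coeff_ofCoeff, extend_adj])

theorem coeff_incl (n : ℕ) (M : S.Alg A n) : S.coeff (S.incl n M) = S.extend n (S.coeff M) :=
  S.coeff_ofCoeff _ _

variable {B : Type*} [Ring B] [StarRing B] [Algebra E B] [StarModule E B]

/-- The map `φ_n : A_n → B_n`, `∑_t (X_t ⊗ id) V_t ↦ ∑_t (φ(X_t) ⊗ id) V_t`, induced by a unital
`E`-linear `*`-homomorphism `φ : A → B`. -/
def mapAlg (φ : A →⋆ₐ[E] B) (n : ℕ) : S.Alg A n →⋆ₐ[E] S.Alg B n where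
  toFun M := S.ofCoeff n fun t => φ (S.coeff M t)
  map_one' := S.coeff_injective (by
    rw [coeff_ofCoeff, ← map_one (algebraMap E (S.Alg A n)), coeff_algebraMap,
      ← map_one (algebraMap E (S.Alg B n)), coeff_algebraMap]
    funext t
    by_cases h : t = 1
    · subst h; simp
    · simp [Pi.single_eq_of_ne h])
  map_mul' M N := S.coeff_injective (by
    rw [coeff_ofCoeff, coeff_mul, coeff_mul, coeff_ofCoeff, coeff_ofCoeff]
    funext t
    simp [conv, map_sum, map_smul])
  map_zero' := S.coeff_injective (by
    rw [coeff_ofCoeff, coeff_zero, coeff_zero]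
    funext t
    simp)
  map_add' M N := S.coeff_injective (by
    rw [coeff_ofCoeff, coeff_add, coeff_add, coeff_ofCoeff, coeff_ofCoeff]
    funext t
    simp)
  commutes' c := S.coeff_injective (by
    rw [coeff_ofCoeff, coeff_algebraMap, coeff_algebraMap]
    funext t
    by_cases h : t = 1
    · subst h
      simp only [Pi.single_eq_same]
      exact AlgHomClass.commutes φ c
    · simp [Pi.single_eq_of_ne h])
  map_star' M := S.coeff_injective (by
    rw [coeff_ofCoeff, coeff_star, coeff_star, coeff_ofCoeff]
    funext t
    simp [adj, map_smul, map_star])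

theorem coeff_mapAlg (φ : A →⋆ₐ[E] B) (n : ℕ) (M : S.Alg A n) (t : S.Tn n) :
    S.coeff (S.mapAlg φ n M) t = φ (S.coeff M t) :=
  congrFun (S.coeff_ofCoeff _ _) t

theorem mapAlg_incl (φ : A →⋆ₐ[E] B) (n : ℕ) (M : S.Alg A n) :
    S.mapAlg φ (n + 1) (S.incl n M) = S.incl n (S.mapAlg φ n M) := by
  apply S.coeff_injective
  funext t
  rw [coeff_mapAlg, coeff_incl, coeff_incl]
  by_cases ht : (t : T) ∈ S.Tn n
  · rw [extend_of_mem _ _ _ _ ht, extend_of_mem _ _ _ _ ht, coeff_mapAlg]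
  · rw [extend_of_notMem _ _ _ _ ht, extend_of_notMem _ _ _ _ ht, map_zero]

theorem mapAlg_mapAlg {D : Type*} [Ring D] [StarRing D] [Algebra E D] [StarModule E D]
    (ψ : B →⋆ₐ[E] D) (φ : A →⋆ₐ[E] B) (n : ℕ) (M : S.Alg A n) :
    S.mapAlg ψ n (S.mapAlg φ n M) = S.mapAlg (ψ.comp φ) n M := by
  apply S.coeff_injective
  funext t
  rw [coeff_mapAlg, coeff_mapAlg, coeff_mapAlg]
  rfl

theorem mapAlg_id (n : ℕ) (M : S.Alg A n) : S.mapAlg (StarAlgHom.id E A) n M = M := by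
  apply S.coeff_injective
  funext t
  rw [coeff_mapAlg]
  rfl

theorem conv_single_right (n : ℕ) (c : S.Tn n → A) (w s : S.Tn n) (x : A) :
    S.conv n c (Pi.single w x) s
      = (S.f ((s : T) * (w : T)⁻¹) w : E) • (c (s * w⁻¹) * x) := by
  rw [conv, Finset.sum_eq_single (s * w⁻¹)]
  · have h : (s * w⁻¹)⁻¹ * s = w := by group
    have h' : ((s * w⁻¹ : S.Tn n) : T)⁻¹ * (s : T) = w := by push_cast; group
    rw [h, h', Pi.single_eq_same]
    rfl
  · intro u _ hu
    rw [Pi.single_eq_of_ne, mul_zero, smul_zero]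
    rintro rfl
    apply hu
    group
  · exact fun h => absurd (Finset.mem_univ _) h

theorem conv_single_left (n : ℕ) (c : S.Tn n → A) (w s : S.Tn n) (x : A) :
    S.conv n (Pi.single w x) c s
      = (S.f (w : T) ((w : T)⁻¹ * s) : E) • (x * c (w⁻¹ * s)) := by
  rw [conv, Finset.sum_eq_single w]
  · rw [Pi.single_eq_same]
  · intro u _ hu
    rw [Pi.single_eq_of_ne hu, zero_mul, smul_zero]
  · exact fun h => absurd (Finset.mem_univ _) h

theorem coeff_sum {ι : Type*} (n : ℕ) (s : Finset ι) (M : ι → S.Alg A n) :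
    S.coeff (∑ i ∈ s, M i) = ∑ i ∈ s, S.coeff (M i) :=
  map_sum (⟨⟨S.coeff, S.coeff_zero⟩, S.coeff_add⟩ : S.Alg A n →+ (S.Tn n → A)) M s

theorem ofCoeff_eq_sum (n : ℕ) (X : S.Tn n → A) :
    S.ofCoeff n X = ∑ w, S.ofCoeff n (Pi.single w (X w)) := by
  apply S.coeff_injective
  rw [coeff_sum, coeff_ofCoeff]
  simp only [coeff_ofCoeff]
  exact (Finset.univ_sum_single X).symm

end algebra
end SchurSystem

/-- The conditions on a sequence `C`, in which `C n` stands for the element `C_{n+1}` of `E_{n+1}`: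
`A_{n+1} = C_{n+1}^* C_{n+1}` and `B_{n+1} = C_{n+1} C_{n+1}^*` are projections with sum `1`, and
`C_{n+1}` commutes with `E_n ⊆ E_{n+1}`. -/
structure SchurSystem.IsAdmissible {T E : Type*} [Group T] [CommCStarAlgebra E]
    (S : SchurSystem T E) (C : ∀ n : ℕ, S.Alg E (n + 1)) : Prop where
  projA : ∀ n, IsStarProjection (star (C n) * C n)
  projB : ∀ n, IsStarProjection (C n * star (C n))
  add_eq_one : ∀ n, star (C n) * C n + C n * star (C n) = 1
  comm : ∀ (n : ℕ) (x : S.Alg E n), C n * S.incl n x = S.incl n x * C n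

/-- The data of projective `K`-theory: the groups `T_n`, the Schur function `f` and an admissible
sequence `C`. -/
structure KSystem (T E : Type*) [Group T] [CommCStarAlgebra E] extends SchurSystem T E where
  C : ∀ n : ℕ, toSchurSystem.Alg E (n + 1)
  admissible : toSchurSystem.IsAdmissible C

namespace KSystem

variable {T E : Type*} [Group T] [CommCStarAlgebra E] (S : KSystem T E)

section algebra

variable (A : Type*) [Ring A] [StarRing A] [Algebra E A] [StarModule E A]

/-- `C_{n+1}` as an element of `A_{n+1}`, through the inclusion `E_{n+1} ⊆ A_{n+1}` that is induced
by `E ⊆ A`. -/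
def CC (n : ℕ) : S.Alg A (n + 1) := S.mapAlg (StarAlgHom.ofId E A) (n + 1) (S.C n)

variable {A}

theorem coeff_CC (n : ℕ) (t : S.Tn (n + 1)) :
    S.coeff (S.CC A n) t = algebraMap E A (S.coeff (S.C n) t) := S.coeff_mapAlg _ _ _ _

theorem coeff_C_comm (n : ℕ) (w s : S.Tn (n + 1)) (hw : (w : T) ∈ S.Tn n) :
    (S.f ((s : T) * (w : T)⁻¹) w : E) * S.coeff (S.C n) (s * w⁻¹)
      = (S.f (w : T) ((w : T)⁻¹ * s) : E) * S.coeff (S.C n) (w⁻¹ * s) := by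
  have h := congrArg (fun M => S.coeff M s) (S.admissible.comm n (S.ofCoeff n (Pi.single ⟨w, hw⟩ 1)))
  have hx := S.extend_single n ⟨w, hw⟩ (1 : E)
  simpa only [S.coeff_mul, S.coeff_incl, S.coeff_ofCoeff, hx, S.conv_single_right,
    S.conv_single_left, smul_eq_mul, mul_one, one_mul] using h

theorem CC_comm (n : ℕ) (x : S.Alg A n) : Commute (S.CC A n) (S.incl n x) := by
  rw [← S.ofCoeff_coeff x, S.ofCoeff_eq_sum, map_sum]
  refine Commute.sum_right _ _ _ fun w _ => ?_
  apply S.coeff_injective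
  funext s
  rw [S.coeff_mul, S.coeff_mul, S.coeff_incl, S.coeff_ofCoeff, S.extend_single,
    S.conv_single_right, S.conv_single_left, coeff_CC, coeff_CC, ← Algebra.commutes,
    Algebra.commutes, ← Algebra.commutes, ← Algebra.smul_def, ← Algebra.smul_def, smul_smul,
    smul_smul, S.coeff_C_comm n ⟨w, S.mono n.le_succ w.2⟩ s w.2]

variable (A)

/-- The projection `A_{n+1} = C_{n+1}^* C_{n+1}`. -/
def AA (n : ℕ) : S.Alg A (n + 1) := star (S.CC A n) * S.CC A n

/-- The projection `B_{n+1} = C_{n+1} C_{n+1}^*`. -/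
def BB (n : ℕ) : S.Alg A (n + 1) := S.CC A n * star (S.CC A n)

theorem AA_eq (n : ℕ) :
    S.AA A n = S.mapAlg (StarAlgHom.ofId E A) (n + 1) (star (S.C n) * S.C n) := by
  rw [map_mul, map_star]; rfl

theorem BB_eq (n : ℕ) :
    S.BB A n = S.mapAlg (StarAlgHom.ofId E A) (n + 1) (S.C n * star (S.C n)) := by
  rw [map_mul, map_star]; rfl

theorem AA_mul_AA (n : ℕ) : S.AA A n * S.AA A n = S.AA A n := by
  rw [AA_eq, ← map_mul, (S.admissible.projA n).isIdempotentElem.eq]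

theorem star_AA (n : ℕ) : star (S.AA A n) = S.AA A n := by
  rw [AA_eq, ← map_star, (S.admissible.projA n).isSelfAdjoint.star_eq]

theorem AA_add_BB (n : ℕ) : S.AA A n + S.BB A n = 1 := by
  rw [AA_eq, BB_eq, ← map_add, S.admissible.add_eq_one, map_one]

variable {A}

theorem AA_comm (n : ℕ) (x : S.Alg A n) : Commute (S.AA A n) (S.incl n x) := by
  have h := S.CC_comm n (star x)
  have h' := h.star_star
  rw [map_star, star_star] at h'
  exact h'.mul_left (S.CC_comm n x)

/-- The map `A_n → A_{n+1}`, `X ↦ A_{n+1} X`. -/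
def rhoBar (n : ℕ) : S.Alg A n →⋆ₙₐ[E] S.Alg A (n + 1) where
  toFun x := S.AA A n * S.incl n x
  map_smul' c x := by
    rw [map_smul, mul_smul_comm]
    rfl
  map_zero' := by rw [map_zero, mul_zero]
  map_add' x y := by rw [map_add, mul_add]
  map_mul' x y := by
    rw [map_mul]
    calc S.AA A n * (S.incl n x * S.incl n y)
        = S.AA A n * S.AA A n * S.incl n x * S.incl n y := by rw [AA_mul_AA, mul_assoc]
      _ = S.AA A n * (S.AA A n * S.incl n x) * S.incl n y := by simp only [mul_assoc]
      _ = S.AA A n * (S.incl n x * S.AA A n) * S.incl n y := by rw [(S.AA_comm n x).eq]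
      _ = S.AA A n * S.incl n x * (S.AA A n * S.incl n y) := by simp only [mul_assoc]
  map_star' x := by rw [map_star, star_mul, star_AA, ← map_star, (S.AA_comm n _).eq]

/-- The map `ρ_{n,m} : A_m → A_n` for `m ≤ n`, the composition of the maps `rhoBar`. -/
def rho (m n : ℕ) (h : m ≤ n) : S.Alg A m →⋆ₙₐ[E] S.Alg A n :=
  Nat.leRec (motive := fun n _ => S.Alg A m →⋆ₙₐ[E] S.Alg A n)
    (NonUnitalStarAlgHom.id E (S.Alg A m)) (fun k _ g => (S.rhoBar k).comp g) h

theorem rho_self (m : ℕ) (x : S.Alg A m) : S.rho m m le_rfl x = x := by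
  rw [rho, Nat.leRec_self]
  rfl

theorem rho_succ (m n : ℕ) (h : m ≤ n) (x : S.Alg A m) :
    S.rho m (n + 1) (h.trans n.le_succ) x = S.rhoBar n (S.rho m n h x) := by
  rw [rho, Nat.leRec_succ _ _ h]
  rfl

instance instDirectedSystem : DirectedSystem (fun n => S.Alg A n) (fun i j h => S.rho i j h) where
  map_self i x := S.rho_self i x
  map_map k j i hij hjk x := by
    induction hjk with
    | refl => exact S.rho_self _ _
    | step h ih =>
      rw [S.rho_succ _ _ h, ih, S.rho_succ _ _ (hij.trans h)]

variable (A)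

/-- The algebraic inductive limit `A_→` of the system `(A_n, ρ_{n,m})`, an involutive algebra. -/
def Lim : Type _ := DirectLimit (fun n => S.Alg A n) (fun i j h => S.rho (A := A) i j h)

instance instNonUnitalRingLim : NonUnitalRing (S.Lim A) :=
  inferInstanceAs
    (NonUnitalRing (DirectLimit (fun n => S.Alg A n) (fun i j h => S.rho (A := A) i j h)))

instance instStarRingLim : StarRing (S.Lim A) :=
  inferInstanceAs
    (StarRing (DirectLimit (fun n => S.Alg A n) (fun i j h => S.rho (A := A) i j h)))

theorem AA_mul_BB (n : ℕ) : S.AA A n * S.BB A n = 0 := by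
  have h := congrArg (fun z => S.AA A n * z) (S.AA_add_BB A n)
  simpa [mul_add, AA_mul_AA] using h

theorem BB_mul_BB (n : ℕ) : S.BB A n * S.BB A n = S.BB A n := by
  rw [BB_eq, ← map_mul, (S.admissible.projB n).isIdempotentElem.eq]

variable {A}

/-- The canonical map `ρ_n : A_n → A_→`. -/
def toLim (n : ℕ) (x : S.Alg A n) : S.Lim A :=
  Quotient.mk (DirectLimit.setoid (fun i j h => S.rho (A := A) i j h)) ⟨n, x⟩

theorem toLim_mul (n : ℕ) (x y : S.Alg A n) : S.toLim n (x * y) = S.toLim n x * S.toLim n y :=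
  (DirectLimit.mul_def (G := fun n => S.Alg A n) (f := fun i j h => S.rho (A := A) i j h)
    n x y).symm

theorem toLim_add (n : ℕ) (x y : S.Alg A n) : S.toLim n (x + y) = S.toLim n x + S.toLim n y :=
  (DirectLimit.add_def (G := fun n => S.Alg A n) (f := fun i j h => S.rho (A := A) i j h)
    n x y).symm

theorem toLim_star (n : ℕ) (x : S.Alg A n) : S.toLim n (star x) = star (S.toLim n x) := rfl

theorem toLim_zero (n : ℕ) : S.toLim n (0 : S.Alg A n) = 0 :=
  (DirectLimit.zero_def (G := fun n => S.Alg A n) (f := fun i j h => S.rho (A := A) i j h)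
    n).symm

theorem exists_toLim (z : S.Lim A) : ∃ n x, z = S.toLim n x :=
  DirectLimit.exists_eq_mk (f := fun i j h => S.rho (A := A) i j h) z

theorem exists_toLim₂ (z w : S.Lim A) : ∃ n x y, z = S.toLim n x ∧ w = S.toLim n y :=
  DirectLimit.exists_eq_mk₂ (f := fun i j h => S.rho (A := A) i j h) z w

theorem toLim_rhoBar (n : ℕ) (x : S.Alg A n) : S.toLim (n + 1) (S.rhoBar n x) = S.toLim n x := by
  have h := DirectLimit.mk_apply (f := fun i j h => S.rho (A := A) i j h) n (n + 1) x n.le_succ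
  rw [S.rho_succ n n le_rfl, rho_self] at h
  exact h

variable (A)

instance instHasOrthogonalCopies : HasOrthogonalCopies (S.Lim A) where
  exists_orthogonal p q := by
    obtain ⟨n, a, b, hp', hq'⟩ := S.exists_toLim₂ (p : S.Lim A) (q : S.Lim A)
    rw [← toLim_rhoBar] at hp' hq'
    have hAb : S.AA A n * S.rhoBar n b = S.rhoBar n b := by
      change S.AA A n * (S.AA A n * S.incl n b) = S.AA A n * S.incl n b
      rw [← mul_assoc, AA_mul_AA]
    have hcq : star (S.toLim (n + 1) (S.CC A n)) * S.toLim (n + 1) (S.CC A n) * q = q := by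
      rw [hq', ← toLim_star, ← toLim_mul, ← toLim_mul]
      exact congrArg _ hAb
    generalize hc : S.toLim (n + 1) (S.CC A n) = c at hcq
    have h1 : (c * q * star c) * (c * q * star c) = c * q * star c := by
      rw [mul_assoc, mul_assoc c, ← mul_assoc (star c) _, ← mul_assoc (star c), hcq,
        ← mul_assoc (q : S.Lim A), q.mul_self, ← mul_assoc]
    have h2 : star (c * q * star c) = c * q * star c := by
      rw [star_mul, star_mul, star_star, q.star_self, mul_assoc]
    refine ⟨p, ⟨c * q * star c, h1, h2⟩, MvN.refl p, ⟨c * q, ?_, ?_⟩, ?_⟩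
    · rw [star_mul, q.star_self, mul_assoc, ← mul_assoc (star c), hcq, q.mul_self]
    · change _ = c * q * star c
      rw [star_mul, q.star_self, mul_assoc, ← mul_assoc (q : S.Lim A), q.mul_self, ← mul_assoc]
    · change (p : S.Lim A) * (c * q * star c) = 0
      rw [hp', hq', ← hc, ← toLim_star, ← toLim_mul, ← toLim_mul, ← toLim_mul]
      refine Eq.trans (congrArg (S.toLim (n + 1)) ?_) (S.toLim_zero (n + 1))
      have e1 : S.CC A n * S.rhoBar n b * star (S.CC A n) = S.incl n b * S.BB A n := by
        calc S.CC A n * (S.AA A n * S.incl n b) * star (S.CC A n)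
            = S.CC A n * (S.incl n b * S.AA A n) * star (S.CC A n) := by
              rw [(S.AA_comm n b).eq]
          _ = (S.CC A n * S.incl n b) * S.AA A n * star (S.CC A n) := by
              rw [← mul_assoc (S.CC A n)]
          _ = (S.incl n b * S.CC A n) * (star (S.CC A n) * S.CC A n) * star (S.CC A n) := by
              rw [(S.CC_comm n b).eq]; rfl
          _ = S.incl n b * (S.BB A n * S.BB A n) := by
              unfold BB; simp only [mul_assoc]
          _ = S.incl n b * S.BB A n := by rw [BB_mul_BB]
      rw [e1]
      change S.AA A n * S.incl n a * (S.incl n b * S.BB A n) = 0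
      rw [← mul_assoc, mul_assoc (S.AA A n), ← map_mul, (S.AA_comm n _).eq, mul_assoc, AA_mul_BB,
        mul_zero]

variable {A} {B : Type*} [Ring B] [StarRing B] [Algebra E B] [StarModule E B]

theorem mapAlg_CC (φ : A →⋆ₐ[E] B) (n : ℕ) : S.mapAlg φ (n + 1) (S.CC A n) = S.CC B n := by
  apply S.coeff_injective
  funext t
  rw [S.coeff_mapAlg, coeff_CC, coeff_CC]
  exact AlgHomClass.commutes φ _

theorem mapAlg_rhoBar (φ : A →⋆ₐ[E] B) (n : ℕ) (x : S.Alg A n) :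
    S.mapAlg φ (n + 1) (S.rhoBar n x) = S.rhoBar n (S.mapAlg φ n x) := by
  change S.mapAlg φ (n + 1) (star (S.CC A n) * S.CC A n * S.incl n x) =
    star (S.CC B n) * S.CC B n * S.incl n (S.mapAlg φ n x)
  rw [map_mul, map_mul, map_star, mapAlg_CC, S.mapAlg_incl]

theorem mapAlg_rho (φ : A →⋆ₐ[E] B) (m n : ℕ) (h : m ≤ n) (x : S.Alg A m) :
    S.mapAlg φ n (S.rho m n h x) = S.rho m n h (S.mapAlg φ m x) := by
  induction h with
  | refl => erw [rho_self, rho_self]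
  | step h ih => rw [S.rho_succ _ _ h, S.rho_succ _ _ h, mapAlg_rhoBar, ih]

/-- The map underlying `limMap`. -/
def limMapFun (φ : A →⋆ₐ[E] B) : S.Lim A → S.Lim B :=
  DirectLimit.map (fun i j h => S.rho (A := A) i j h) (fun i j h => S.rho (A := B) i j h)
    (fun n => S.mapAlg φ n) (fun m n h x => (S.mapAlg_rho φ m n h x).symm)

theorem limMapFun_toLim (φ : A →⋆ₐ[E] B) (n : ℕ) (x : S.Alg A n) :
    S.limMapFun φ (S.toLim n x) = S.toLim n (S.mapAlg φ n x) := rfl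

/-- The `*`-homomorphism `φ_→ : A_→ → B_→` induced by `φ : A → B`, with
`φ_→ ∘ ρ_n = ρ_n ∘ φ_n`. -/
def limMap (φ : A →⋆ₐ[E] B) : S.Lim A →⋆ₙ+* S.Lim B where
  toFun := S.limMapFun φ
  map_mul' z w := by
    obtain ⟨n, x, y, rfl, rfl⟩ := S.exists_toLim₂ z w
    rw [← toLim_mul, limMapFun_toLim, limMapFun_toLim, limMapFun_toLim, map_mul, toLim_mul]
  map_zero' := by
    rw [← S.toLim_zero 0, limMapFun_toLim, map_zero, toLim_zero]
  map_add' z w := by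
    obtain ⟨n, x, y, rfl, rfl⟩ := S.exists_toLim₂ z w
    rw [← toLim_add, limMapFun_toLim, limMapFun_toLim, limMapFun_toLim, map_add, toLim_add]
  map_star' z := by
    obtain ⟨n, x, rfl⟩ := S.exists_toLim z
    rw [← toLim_star, limMapFun_toLim, limMapFun_toLim, map_star, toLim_star]

theorem limMap_toLim (φ : A →⋆ₐ[E] B) (n : ℕ) (x : S.Alg A n) :
    S.limMap φ (S.toLim n x) = S.toLim n (S.mapAlg φ n x) := rfl

theorem limMap_limMap {D : Type*} [Ring D] [StarRing D] [Algebra E D] [StarModule E D]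
    (ψ : B →⋆ₐ[E] D) (φ : A →⋆ₐ[E] B) (x : S.Lim A) :
    S.limMap ψ (S.limMap φ x) = S.limMap (ψ.comp φ) x := by
  obtain ⟨n, y, rfl⟩ := S.exists_toLim x
  exact congrArg (S.toLim n) (S.mapAlg_mapAlg ψ φ n y)

variable (A)

/-- The group `K_0(A)` of a full `E`-C*-algebra `A`: the Grothendieck group of the semigroup of
classes of projections in `A_→`. -/
def K0Full : Type _ := Algebra.GrothendieckAddGroup (ProjClass (S.Lim A))

instance instAddCommGroupK0Full : AddCommGroup (S.K0Full A) :=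
  inferInstanceAs (AddCommGroup (Algebra.GrothendieckAddGroup (ProjClass (S.Lim A))))

/-- The Grothendieck map of the semigroup of classes of projections in `A_→`. -/
def groth : ProjClass (S.Lim A) →+ S.K0Full A := Algebra.GrothendieckAddGroup.of

variable {A}

/-- The universal property of the Grothendieck group. -/
def K0FullLift {H : Type*} [AddCommGroup H] (g : ProjClass (S.Lim A) →+ H) : S.K0Full A →+ H :=
  Algebra.GrothendieckAddGroup.lift g

theorem K0FullLift_groth {H : Type*} [AddCommGroup H] (g : ProjClass (S.Lim A) →+ H)
    (a : ProjClass (S.Lim A)) : S.K0FullLift g (S.groth A a) = g a :=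
  DFunLike.congr_fun (Algebra.GrothendieckAddGroup.lift.symm_apply_apply g) a

/-- The class `[P]_0` of a projection `P` of `A_→`. -/
def cls (P : Proj (S.Lim A)) : S.K0Full A := S.groth A (ProjClass.mk P)

theorem K0Full_hom_ext {H : Type*} [AddCommGroup H] {f g : S.K0Full A →+ H}
    (h : ∀ P, f (S.cls P) = g (S.cls P)) : f = g := by
  apply (Algebra.GrothendieckAddGroup.lift (M := ProjClass (S.Lim A))).symm.injective
  ext a
  obtain ⟨P, rfl⟩ := a.exists_rep
  exact h P

/-- The homomorphism `K_0(φ)` for a unital `E`-linear `*`-homomorphism `φ`,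
`[P]_0 ↦ [φ_→ P]_0`. -/
def K0FullMap (φ : A →⋆ₐ[E] B) : S.K0Full A →+ S.K0Full B :=
  S.K0FullLift ((S.groth B).comp (ProjClass.map (S.limMap φ)))

theorem K0FullMap_cls (φ : A →⋆ₐ[E] B) (P : Proj (S.Lim A)) :
    S.K0FullMap φ (S.cls P) = S.cls (P.map (S.limMap φ)) :=
  S.K0FullLift_groth _ _

theorem K0FullMap_comp {D : Type*} [Ring D] [StarRing D] [Algebra E D] [StarModule E D]
    (ψ : B →⋆ₐ[E] D) (φ : A →⋆ₐ[E] B) :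
    (S.K0FullMap ψ).comp (S.K0FullMap φ) = S.K0FullMap (ψ.comp φ) := by
  apply S.K0Full_hom_ext
  intro P
  rw [AddMonoidHom.comp_apply, K0FullMap_cls, K0FullMap_cls, K0FullMap_cls]
  exact congrArg S.cls (Subtype.ext (S.limMap_limMap ψ φ P))

end algebra

end KSystem

/-! ### `E`-C*-algebras -/

/-- An `E`-C*-algebra: a C*-algebra `F` with a bilinear exterior multiplication `E × F → F`
compatible with the products, the involutions and the norms. -/
class ECStarAlgebra (E F : Type*) [CommCStarAlgebra E] [NonUnitalCStarAlgebra F] extends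
    Module E F, IsScalarTower E F F, SMulCommClass E F F, StarModule E F where
  smul_assoc_complex : ∀ (c : ℂ) (α : E) (x : F), (c • α) • x = c • (α • x)
  norm_smul_le : ∀ (α : E) (x : F), ‖α • x‖ ≤ ‖α‖ * ‖x‖

section ECStar

variable {E F G : Type*} [CommCStarAlgebra E] [NonUnitalCStarAlgebra F] [ECStarAlgebra E F]
  [NonUnitalCStarAlgebra G] [ECStarAlgebra E G]

/-- The projection `π^F : E ⊕ F → E`, `(α, x) ↦ α`, of the unitization `E ⊕ F`, in which
`(α, x) (β, y) = (α β, α y + β x + x y)` and `(α, x)^* = (α^*, x^*)`. -/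
def augmentation (E F : Type*) [CommCStarAlgebra E] [NonUnitalCStarAlgebra F] [ECStarAlgebra E F] :
    Unitization E F →⋆ₐ[E] E where
  __ := Unitization.fstHom E F
  map_star' _ := rfl

/-- The unital homomorphism `(α, x) ↦ (α, φ x)` of the unitizations induced by `φ`. -/
def checkMap (φ : F →⋆ₙₐ[E] G) : Unitization E F →⋆ₐ[E] Unitization E G := Unitization.starMap φ

theorem augmentation_comp_checkMap (φ : F →⋆ₙₐ[E] G) :
    (augmentation E G).comp (checkMap φ) = augmentation E F := by
  ext x
  change (Unitization.starMap φ (x : Unitization E F)).fst = (x : Unitization E F).fst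
  rw [Unitization.starMap_inr, Unitization.fst_inr, Unitization.fst_inr]

variable {T : Type*} [Group T] (S : KSystem T E)

/-- The group `K_0(F)` of an `E`-C*-algebra `F`: the kernel of `K_0(π^F)`. -/
def KSystem.K0 (F : Type*) [NonUnitalCStarAlgebra F] [ECStarAlgebra E F] :
    AddSubgroup (S.K0Full (Unitization E F)) :=
  (S.K0FullMap (augmentation E F)).ker

theorem KSystem.K0FullMap_mem_K0 (φ : F →⋆ₙₐ[E] G) (x : S.K0Full (Unitization E F))
    (hx : x ∈ S.K0 F) : S.K0FullMap (checkMap φ) x ∈ S.K0 G := by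
  have h := DFunLike.congr_fun (S.K0FullMap_comp (augmentation E G) (checkMap φ)) x
  rw [augmentation_comp_checkMap] at h
  exact AddMonoidHom.mem_ker.2 (h.trans (AddMonoidHom.mem_ker.1 hx))

/-- The homomorphism `K_0(φ)` for an `E`-linear `*`-homomorphism `φ`: the restriction of the
homomorphism induced by `(α, x) ↦ (α, φ x)`. -/
def KSystem.K0Map (φ : F →⋆ₙₐ[E] G) : S.K0 F →+ S.K0 G :=
  ((S.K0FullMap (checkMap φ)).comp (S.K0 F).subtype).codRestrict (S.K0 G)
    fun x => S.K0FullMap_mem_K0 φ x.1 x.2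

end ECStar

/-- `(L, ι)` is the inductive limit of the inductive system `(F, φ)` in the category of
`E`-C*-algebras and `E`-linear `*`-homomorphisms: it is a cocone and every cocone factors uniquely
through it. -/
structure IsInductiveLimit.{u, v, w} {E : Type w} [CommCStarAlgebra E] {I : Type v} [Preorder I]
    {F : I → Type u} [∀ i, NonUnitalCStarAlgebra (F i)] [∀ i, ECStarAlgebra E (F i)]
    (φ : ∀ i j, i ≤ j → F i →⋆ₙₐ[E] F j)
    {L : Type (max u v)} [NonUnitalCStarAlgebra L] [ECStarAlgebra E L]
    (ι : ∀ i, F i →⋆ₙₐ[E] L) : Prop where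
  compat : ∀ (i j : I) (h : i ≤ j), (ι j).comp (φ i j h) = ι i
  existsUnique_desc : ∀ (G : Type (max u v)) [NonUnitalCStarAlgebra G] [ECStarAlgebra E G]
    (g : ∀ i, F i →⋆ₙₐ[E] G), (∀ (i j : I) (h : i ≤ j), (g j).comp (φ i j h) = g i) →
      ∃! k : L →⋆ₙₐ[E] G, ∀ i, k.comp (ι i) = g i

end

end ProjK

universe u v w t

namespace ProjK

/-! ### Functional calculus in Banach `*`-algebras -/

section Banach

/-! Continuity of `K_0` rests on two facts about projections: up to equivalence a projection over
the limit comes from some `F_i`, and an equivalence that appears over the limit already appears over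
some `F_j`. Both are perturbation arguments, and they are carried out level by level in the algebras
of `T_n`-families.

The definition of `K_0` uses only the algebraic `*`-structure of these algebras, so any complete
norm may serve as a tool. The unitizations and the algebras `S.Alg A n` receive `ℓ¹`-norms, which
make them Banach `*`-algebras with isometric involution. In place of C*-functional calculus stands
one power series: the Catalan generating function solves `w = h + w ^ 2`, whence `(1 - 2 w) ^ 2 = 1
- 4 h`. The resulting inverse square root straightens almost-projections (`exists_proj_near`) and
almost-partial isometries (`mvn_of_approx`).

The link with the universal property is `IsNormColimit`: dense images, and the norm of an element of
the limit approached along the system. `IsInductiveLimit.isNormColimit` proves it for an inductive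
limit `L`. Density holds because the closure of the union of the images is an `E`-C*-algebra through
which the cocone factors. For the norm, the system also maps to the algebra of bounded families
modulo asymptotically vanishing ones, whose norm is `limsup ‖x i‖`; the induced map from `L` to that
algebra is contractive.

The property passes to unitizations and, coordinate by coordinate, to each `S.Alg A n`. There
`IsNormColimit.exists_mvn_lift` and `IsNormColimit.exists_mvn_map` give the two facts. Since a
projection or an equivalence in the algebraic limit over `n` lives at a finite level, they hold for
classes in `S.Lim`, then for Grothendieck groups, and finally for the kernels that define `K_0`,
because the augmentations commute with the maps of the system. -/

theorem catalan_le_four_pow (n : ℕ) : catalan n ≤ 4 ^ n := by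
  rw [catalan_eq_centralBinom_div]
  exact (Nat.div_le_self _ _).trans n.centralBinom_le_four_pow

/-- Only positive powers of `h` occur, so the estimate does not need `‖1‖ = 1`, which a normed ring
does not guarantee. -/
theorem norm_catalan_nsmul_pow_le {R : Type*} [NormedRing R] (h : R) (n : ℕ) :
    ‖catalan n • h ^ (n + 1)‖ ≤ ‖h‖ * (4 * ‖h‖) ^ n := by
  calc ‖catalan n • h ^ (n + 1)‖ ≤ catalan n * ‖h ^ (n + 1)‖ := norm_nsmul_le
    _ ≤ 4 ^ n * ‖h‖ ^ (n + 1) := by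
        gcongr
        · exact_mod_cast catalan_le_four_pow n
        · exact norm_pow_le' h n.succ_pos
    _ = ‖h‖ * (4 * ‖h‖) ^ n := by ring

variable {R : Type*} [NormedRing R] [CompleteSpace R] [StarRing R] [NormedStarGroup R]

/-- The small solution of `w = h + w ^ 2`. -/
theorem exists_eq_add_mul_self (h : R) (hh : ‖h‖ ≤ 1 / 8) :
    ∃ w : R, w = h + w * w ∧ ‖w‖ ≤ 2 * ‖h‖ ∧ (∀ c, Commute c h → Commute c w) ∧
      (star h = h → star w = w) := by
  have h4 : 4 * ‖h‖ < 1 := by linarith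
  have h0 : 0 ≤ 4 * ‖h‖ := by positivity
  have hgeo := (hasSum_geometric_of_lt_one h0 h4).mul_left ‖h‖
  have hbd := norm_catalan_nsmul_pow_le h
  have hs : Summable fun n => ‖catalan n • h ^ (n + 1)‖ :=
    Summable.of_nonneg_of_le (fun _ => norm_nonneg _) hbd hgeo.summable
  have hs' := hs.of_norm
  -- The Catalan recursion is the equation `w = h + w ^ 2` read off coefficientwise through the
  -- Cauchy product. The series is dominated by a geometric one of ratio `4 ‖h‖ ≤ 1 / 2`, hence the
  -- factor `2` in the bound.
  refine ⟨∑' n, catalan n • h ^ (n + 1), ?_, ?_, ?_, ?_⟩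
  · rw [tsum_mul_tsum_eq_tsum_sum_antidiagonal_of_summable_norm hs hs, hs'.tsum_eq_zero_add]
    congr 1
    · simp
    · refine tsum_congr fun n => ?_
      rw [catalan_succ', Finset.sum_smul]
      refine Finset.sum_congr rfl fun ij hij => ?_
      rw [← Finset.HasAntidiagonal.mem_antidiagonal.1 hij, smul_mul_smul_comm, ← pow_add]
      congr 2
      ring
  · refine (tsum_of_norm_bounded hgeo hbd).trans ?_
    rw [mul_comm]
    gcongr
    rw [inv_le_comm₀ (by linarith) (by norm_num)]
    linarith
  · intro c hc
    exact Commute.tsum_right _ fun n => (hc.pow_right _).smul_right _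
  · intro hst
    rw [tsum_star]
    refine tsum_congr fun n => ?_
    rw [star_nsmul, star_pow, hst]

/-- A small solution `z` of `1 + 4 (z + z ^ 2) = (1 - 4 h)⁻¹`. -/
theorem exists_invSqrt (h : R) (hh : ‖h‖ ≤ 1 / 8) :
    ∃ z : R, (z + z * z) * (1 - 4 * h) = h ∧ ‖z‖ ≤ 4 * ‖h‖ ∧ (∀ c, Commute c h → Commute c z) ∧
      (star h = h → star z = z) := by
  obtain ⟨w, hw, hwn, hwc, hws⟩ := exists_eq_add_mul_self h hh
  have h2w : ‖2 * w‖ ≤ 2 * ‖w‖ := by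
    rw [two_mul, two_mul]; exact norm_add_le _ _
  -- Here `‖2 w‖ ≤ 4 ‖h‖ ≤ 1 / 2`, so `1 - 2 w`, a square root of `1 - 4 h`, is invertible by the
  -- Neumann series.
  obtain ⟨u, hu⟩ : ∃ u : Rˣ, (u : R) = 1 - 2 * w :=
    ⟨Units.oneSub (2 * w) (by linarith), rfl⟩
  have hcw : ∀ c, Commute c w → Commute c (↑u⁻¹ : R) := fun c hc => by
    refine Commute.units_inv_right ?_
    rw [hu]
    exact (Commute.one_right c).sub_right ((Commute.ofNat_right c 2).mul_right hc)
  have hwu : Commute w (↑u⁻¹ : R) := hcw w (Commute.refl w)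
  have hw1 : w * w = w - h := by rw [eq_sub_iff_add_eq, add_comm]; exact hw.symm
  have hinv : (↑u⁻¹ : R) * (1 - 2 * w) = 1 := by rw [← hu, Units.inv_mul]
  have hsq : (1 - 4 * h) = (1 - 2 * w) * (1 - 2 * w) := by
    have : (1 - 2 * w) * (1 - 2 * w) = 1 - 4 * w + 4 * (w * w) := by noncomm_ring
    rw [this, hw1]; noncomm_ring
  -- With `z = w (1 - 2 w)⁻¹` one has `1 + 2 z = (1 - 2 w)⁻¹`, the inverse square root of `1 - 4 h`.
  refine ⟨w * ↑u⁻¹, ?_, ?_, ?_, ?_⟩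
  · have e1 : w * ↑u⁻¹ + w * ↑u⁻¹ * (w * ↑u⁻¹) = (w * (1 - 2 * w) + w * w) * ↑u⁻¹ * ↑u⁻¹ := by
      have : w * ↑u⁻¹ * (w * ↑u⁻¹) = w * w * ↑u⁻¹ * ↑u⁻¹ := by
        rw [mul_assoc, ← mul_assoc (↑u⁻¹ : R), ← hwu.eq]; simp only [mul_assoc]
      rw [this, add_mul, add_mul, ← hu, Units.mul_inv_cancel_right]
    have e2 : w * (1 - 2 * w) + w * w = h := by
      have : w * (1 - 2 * w) + w * w = w - w * w := by noncomm_ring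
      rw [this, hw1]; abel
    rw [e1, e2, hsq, mul_assoc, ← mul_assoc (↑u⁻¹ : R) (1 - 2 * w), hinv, one_mul, mul_assoc, hinv,
      mul_one]
  -- From `z = w + 2 w z` and `2 ‖w‖ ≤ 1 / 2` follows `‖z‖ ≤ 2 ‖w‖ ≤ 4 ‖h‖`.
  · have e : w * ↑u⁻¹ = w + 2 * w * (w * ↑u⁻¹) := by
      have h1 : w * ↑u⁻¹ * (1 - 2 * w) = w := by rw [mul_assoc, hinv, mul_one]
      have h2 : Commute (w * ↑u⁻¹) (2 * w) :=
        (Commute.ofNat_right _ 2).mul_right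
          ((Commute.refl w).mul_left hwu.symm)
      rw [mul_sub, mul_one, h2.eq] at h1
      rw [← sub_eq_iff_eq_add]; exact h1
    have h3 : ‖w * ↑u⁻¹‖ ≤ ‖w‖ + 2 * ‖w‖ * ‖w * ↑u⁻¹‖ := by
      conv_lhs => rw [e]
      refine (norm_add_le _ _).trans ?_
      gcongr
      exact (norm_mul_le _ _).trans (by gcongr)
    have h4 : 2 * ‖w‖ * ‖w * ↑u⁻¹‖ ≤ 1 / 2 * ‖w * ↑u⁻¹‖ := by
      gcongr
      linarith
    linarith
  · intro c hc
    exact (hwc c hc).mul_right (hcw c (hwc c hc))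
  · intro hst
    have hstu : star u = u := Units.ext (by
      rw [Units.coe_star, hu, star_sub, star_one, star_mul, hws hst, star_ofNat]
      exact congrArg _ (Commute.ofNat_right w 2).eq)
    have : star (↑u⁻¹ : R) = ↑u⁻¹ := by
      rw [← Units.coe_star, star_inv, hstu]
    rw [star_mul, this, hws hst, hwu.eq]

/-- Near an almost idempotent self-adjoint element there is a projection. -/
theorem exists_proj_near (a : R) (ha : star a = a)
    (hh : ‖a - a * a‖ ≤ 1 / 8) :
    ∃ (q : Proj R) (z : R), (q : R) = a - (z - 2 * (a * z)) ∧ ‖z‖ ≤ 4 * ‖a - a * a‖ := by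
  obtain ⟨z, hz, hzn, hzc, hzs⟩ := exists_invSqrt (a - a * a) hh
  have hst : star (a - a * a) = a - a * a := by rw [star_sub, star_mul, ha]
  have hc : a * z = z * a :=
    (hzc a ((Commute.refl a).sub_right ((Commute.refl a).mul_right (Commute.refl a)))).eq
  -- This `q` satisfies `1 - 2 q = (1 - 2 a) (1 + 2 z)`. As `(1 - 2 a) ^ 2 = 1 - 4 (a - a ^ 2)` and
  -- `1 + 2 z` is the inverse square root of that element, `1 - 2 q` is an involution: it is the
  -- sign of `1 - 2 a`.
  refine ⟨⟨a - (z - 2 * (a * z)), ?_, ?_⟩, z, rfl, hzn⟩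
  · change (a - (z - 2 * (a * z))) * (a - (z - 2 * (a * z))) = a - (z - 2 * (a * z))
    have e : (a - (z - 2 * (a * z))) * (a - (z - 2 * (a * z))) - (a - (z - 2 * (a * z)))
        = (z + z * z) * (1 - 4 * (a - a * a)) - (a - a * a) := by
      have h1 : z * (a * z) = a * (z * z) := by rw [← mul_assoc, ← hc, mul_assoc]
      have h2 : z * (a * a) = a * (a * z) := by rw [← mul_assoc, ← hc, mul_assoc, ← hc]
      have h3 : z * (a * (a * z)) = a * (a * (z * z)) := by
        rw [← mul_assoc, ← hc, mul_assoc, h1]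
      simp only [mul_sub, sub_mul, mul_add, add_mul, mul_assoc, two_mul, mul_one,
        show (4 : R) = 1 + 1 + 1 + 1 by norm_num, one_mul, h1, h2, h3, ← hc]
      abel
    rw [hz, sub_self] at e
    exact sub_eq_zero.1 e
  · change star (a - (z - 2 * (a * z))) = a - (z - 2 * (a * z))
    simp only [star_sub, two_mul, star_add, star_mul, ha, hzs hst, ← hc]

/-- An approximate partial isometry between two projections can be corrected. -/
theorem mvn_of_approx (h4 : IsUnit (4 : R)) (p q : Proj R)
    (x h : R) (hxp : x * p = x) (hqx : (q : R) * x = x) (hx : 4 * h = p - star x * x)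
    (hh : ‖h‖ ≤ 1 / 8) (hl : ‖(q : R) - x * star x‖ < 1) : MvN p q := by
  have cancel : ∀ a b : R, 4 * a = 4 * b → a = b := fun a b => h4.mul_left_cancel
  have four : ∀ a : R, Commute 4 a := fun a => Commute.ofNat_left 4 a
  have hpx : (p : R) * star x = star x := by
    have := congrArg star hxp
    rwa [star_mul, p.star_self] at this
  have hst : star h = h := by
    apply cancel
    have := congrArg star hx
    rw [star_mul, star_sub, star_mul, star_star, p.star_self, ← hx, star_ofNat] at this
    rw [(four _).eq, this]
  have hhp : h * p = h := by
    apply cancel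
    rw [← mul_assoc, hx, sub_mul, p.mul_self, mul_assoc, hxp]
  have hph : (p : R) * h = h := by
    have := congrArg star hhp
    rwa [star_mul, hst, p.star_self] at this
  obtain ⟨z, hz, -, hzc, hzs⟩ := exists_invSqrt h hh
  have hpz : Commute (p : R) z := hzc _ (hph.trans hhp.symm)
  have hhz : Commute h z := hzc _ (Commute.refl h)
  -- `r` is the inverse square root of `1 - 4 h`. Since `star x * x = (1 - 4 h) p`, the product `x *
  -- r` is the isometric part of the polar decomposition of `x`.
  set r : R := 1 + 2 * z with hr
  have two : ∀ a : R, Commute a 2 := fun a => Commute.ofNat_right a 2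
  have hpr : Commute (p : R) r := (Commute.one_right _).add_right ((two _).mul_right hpz)
  have hrs : star r = r := by
    rw [hr, star_add, star_one, star_mul, hzs hst, star_ofNat, (two z).eq]
  have hhr : Commute (1 - 4 * h) r :=
    (Commute.one_left _).sub_left ((four r).mul_left
      ((Commute.one_right _).add_right ((two _).mul_right hhz)))
  have hrr : r * r * (1 - 4 * h) = 1 := by
    have : r * r * (1 - 4 * h) = (1 - 4 * h) + 4 * ((z + z * z) * (1 - 4 * h)) := by
      rw [hr]; noncomm_ring
    rw [this, hz, sub_add_cancel]
  have hxx : star x * x = (1 - 4 * h) * p := by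
    rw [sub_mul, one_mul, mul_assoc, hhp, hx, sub_sub_cancel]
  have hv1 : star (x * r) * (x * r) = p := by
    rw [star_mul, hrs]
    calc r * star x * (x * r) = r * (star x * x) * r := by simp only [mul_assoc]
      _ = r * (1 - 4 * h) * (p * r) := by rw [hxx]; simp only [mul_assoc]
      _ = r * ((1 - 4 * h) * r) * p := by rw [hpr.eq]; simp only [mul_assoc]
      _ = p := by rw [hhr.eq, ← mul_assoc, hrr, one_mul]
  have hv2 : (x * r) * star (x * r) = x * (r * r) * star x := by
    rw [star_mul, hrs]; simp only [mul_assoc]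
  have hmul : (x * r) * star (x * r) * (x * star x) = x * star x := by
    rw [hv2]
    calc x * (r * r) * star x * (x * star x) = x * (r * r) * (star x * x) * star x := by
          simp only [mul_assoc]
      _ = x * (r * r * (1 - 4 * h)) * (p * star x) := by rw [hxx]; simp only [mul_assoc]
      _ = x * star x := by rw [hrr, mul_one, hpx]
  have hqv : (x * r) * star (x * r) * q = (x * r) * star (x * r) := by
    have : star x * q = star x := by
      have := congrArg star hqx
      rwa [star_mul, q.star_self] at this
    rw [hv2, mul_assoc, this]
  obtain ⟨u, hu⟩ : ∃ u : Rˣ, (u : R) = 1 - (q - x * star x) := ⟨Units.oneSub _ hl, rfl⟩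
  -- The defect `d = q - (x r)(x r)^*` satisfies `d q = d` and `d (x x^*) = 0`, so `d (1 - (q - x
  -- x^*)) = d - d = 0`. The second factor is invertible because `x x^*` is close to `q`, which
  -- forces `d = 0`.
  have hzero : ((q : R) - (x * r) * star (x * r)) * u = 0 := by
    have hqxx : (q : R) * (x * star x) = x * star x := by rw [← mul_assoc, hqx]
    rw [hu, mul_sub, mul_one, mul_sub, sub_mul, sub_mul, q.mul_self, hqv, hmul, hqxx, sub_self,
      sub_zero, sub_self]
  refine ⟨x * r, hv1, ?_⟩
  have := (Units.mul_left_eq_zero u).1 hzero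
  exact (sub_eq_zero.1 this).symm

end Banach

theorem MvN.map {R R' : Type*} [NonUnitalRing R] [StarRing R] [NonUnitalRing R'] [StarRing R']
    {p q : Proj R} (h : MvN p q) (φ : R →⋆ₙ+* R') :
    MvN (p.map φ) (q.map φ) := by
  obtain ⟨x, h1, h2⟩ := h
  refine ⟨φ x, ?_, ?_⟩
  · rw [← map_star, ← map_mul, h1]; rfl
  · rw [← map_star, ← map_mul, h2]; rfl

/-! ### Norm colimits -/

/-- `Y` is the colimit in the sense of norms of the system `(X, θ)` of contractions: the images of
the maps `η i : X i → Y` are dense, and the norm of `η i x` is approached by the norms of the images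
of `x` in the system. -/
structure IsNormColimit {I : Type*} [Preorder I] {X : I → Type*} {Y : Type*}
    [∀ i, NormedAddCommGroup (X i)] [NormedAddCommGroup Y] (θ : ∀ i j, i ≤ j → X i → X j)
    (η : ∀ i, X i → Y) : Prop where
  map_map : ∀ (i j k : I) (hij : i ≤ j) (hjk : j ≤ k) (x : X i),
    θ j k hjk (θ i j hij x) = θ i k (hij.trans hjk) x
  comp : ∀ (i j : I) (h : i ≤ j) (x : X i), η j (θ i j h x) = η i x
  norm_map_le : ∀ (i j : I) (h : i ≤ j) (x : X i), ‖θ i j h x‖ ≤ ‖x‖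
  norm_le : ∀ (i : I) (x : X i), ‖η i x‖ ≤ ‖x‖
  dense : ∀ (y : Y) (ε : ℝ), 0 < ε → ∃ (i : I) (x : X i), ‖η i x - y‖ < ε
  exists_norm_lt : ∀ (i : I) (x : X i) (ε : ℝ), 0 < ε →
    ∃ (j : I) (h : i ≤ j), ‖θ i j h x‖ < ‖η i x‖ + ε

/-! ### Lifting projections and descending equivalences along a norm colimit -/

section Lift

variable {I : Type*} [Preorder I] [IsDirectedOrder I] {R : I → Type*} {R' : Type*}
  [∀ i, NormedRing (R i)] [∀ i, StarRing (R i)] [∀ i, NormedStarGroup (R i)]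
  [∀ i, CompleteSpace (R i)] [NormedRing R'] [StarRing R'] [NormedStarGroup R'] [CompleteSpace R']
  {θ : ∀ i j, i ≤ j → R i →⋆ₙ+* R j} {η : ∀ i, R i →⋆ₙ+* R'}

theorem map_four_mul {A B : Type*} [Ring A] [StarRing A] [Ring B] [StarRing B] (f : A →⋆ₙ+* B)
    (x : A) : f (4 * x) = 4 * f x := by
  have := map_nsmul f 4 x
  simpa only [nsmul_eq_mul, Nat.cast_ofNat] using this

/-- Equivalences of projections descend to a finite stage. -/
theorem IsNormColimit.exists_mvn_map (H : IsNormColimit (fun i j h => θ i j h) (fun i => η i))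
    (h4 : ∀ i, IsUnit (4 : R i)) (h4' : IsUnit (4 : R')) {i : I} (p q : Proj (R i))
    (hpq : MvN (p.map (η i)) (q.map (η i))) :
    ∃ (j : I) (h : i ≤ j), MvN (p.map (θ i j h)) (q.map (θ i j h)) := by
  obtain ⟨v, hv1, hv2, hv3, hv4⟩ := hpq.exists_partialIsometry
  obtain ⟨P, hP⟩ : ∃ P, P = p.map (η i) := ⟨_, rfl⟩
  obtain ⟨Q, hQ⟩ : ∃ Q, Q = q.map (η i) := ⟨_, rfl⟩
  rw [← hP] at hv1 hv3
  rw [← hQ] at hv2 hv4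
  obtain ⟨c, hc⟩ := h4'.exists_left_inv
  have hv5 : (Q : R') * v * P = v := by rw [hv4, hv3]
  -- Both expressions vanish at the partial isometry `v = Q v P`, so they are small at every `y`
  -- near `v`, in particular at one that comes from a finite stage.
  have c1 : Continuous fun y : R' => c * (P - star (Q * y * P) * (Q * y * P) : R') := by fun_prop
  have c2 : Continuous fun y : R' => (Q - (Q * y * P) * star (Q * y * P) : R') := by fun_prop
  have t1 := c1.tendsto v
  have t2 := c2.tendsto v
  rw [hv5, hv1, sub_self, mul_zero] at t1
  rw [hv5, hv2, sub_self] at t2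
  obtain ⟨δ, hδ, hball⟩ := Metric.eventually_nhds_iff.1
    ((t1.eventually (Metric.ball_mem_nhds _ (by norm_num : (0 : ℝ) < 1 / 16))).and
      (t2.eventually (Metric.ball_mem_nhds _ (by norm_num : (0 : ℝ) < 1 / 2))))
  obtain ⟨j₀, y₀, hy₀⟩ := H.dense v δ hδ
  obtain ⟨j, hij, hj⟩ := exists_ge_ge i j₀
  have hηy : η j (θ j₀ j hj y₀) = η j₀ y₀ := H.comp _ _ hj y₀
  generalize θ j₀ j hj y₀ = y at hηy
  rw [← hηy] at hy₀
  obtain ⟨b1, b2⟩ := hball (by rwa [dist_eq_norm])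
  rw [dist_zero_right] at b1 b2
  obtain ⟨d, hd⟩ := (h4 j).exists_right_inv
  obtain ⟨pj, hpj⟩ : ∃ pj, pj = p.map (θ i j hij) := ⟨_, rfl⟩
  obtain ⟨qj, hqj⟩ : ∃ qj, qj = q.map (θ i j hij) := ⟨_, rfl⟩
  have hηp : η j pj = P := by rw [hpj, hP]; exact H.comp i j hij _
  have hηq : η j qj = Q := by rw [hqj, hQ]; exact H.comp i j hij _
  -- Cutting `y` down by the two projections makes the support relations of `mvn_of_approx` exact;
  -- only `x^* x ≈ p` and `x x^* ≈ q` remain approximate.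
  obtain ⟨x, hx⟩ : ∃ x, x = (qj : R j) * y * pj := ⟨_, rfl⟩
  have hηx : η j x = Q * η j y * P := by rw [hx, map_mul, map_mul, hηp, hηq]
  obtain ⟨h, hh⟩ : ∃ h, h = d * ((pj : R j) - star x * x) := ⟨_, rfl⟩
  have hh4 : 4 * h = (pj : R j) - star x * x := by rw [hh, ← mul_assoc, hd, one_mul]
  have hηh : η j h = c * (P - star (Q * η j y * P) * (Q * η j y * P) : R') := by
    have := congrArg (η j) hh4
    rw [map_four_mul, map_sub, map_mul, map_star, hηx, hηp] at this
    rw [← this, ← mul_assoc, hc, one_mul]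
  have hηl : η j ((qj : R j) - x * star x) = (Q - (Q * η j y * P) * star (Q * η j y * P) : R') := by
    rw [map_sub, map_mul, map_star, hηx, hηq]
  rw [← hηh] at b1
  rw [← hηl] at b2
  -- The two smallness conditions are reached one after the other: `1 / 16 + 1 / 16 = 1 / 8` at
  -- `k₁`, then `1 / 2 + 1 / 2 = 1` at `k`. Contractivity preserves the first on the way from `k₁`
  -- to `k`.
  obtain ⟨k₁, hk₁, n1⟩ := H.exists_norm_lt j h (1 / 16) (by norm_num)
  have b2' := b2
  rw [← H.comp j k₁ hk₁] at b2'
  obtain ⟨k, hk, n2⟩ := H.exists_norm_lt k₁ (θ j k₁ hk₁ ((qj : R j) - x * star x)) (1 / 2)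
    (by norm_num)
  have n1' := H.norm_map_le k₁ k hk (θ j k₁ hk₁ h)
  have m1 := H.map_map j k₁ k hk₁ hk h
  have m2 := H.map_map j k₁ k hk₁ hk ((qj : R j) - x * star x)
  have hjk := hk₁.trans hk
  have hpk : p.map (θ i k (hij.trans hjk)) = pj.map (θ j k hjk) := by
    rw [hpj]; exact Subtype.ext (H.map_map i j k hij hjk p).symm
  have hqk : q.map (θ i k (hij.trans hjk)) = qj.map (θ j k hjk) := by
    rw [hqj]; exact Subtype.ext (H.map_map i j k hij hjk q).symm
  refine ⟨k, hij.trans hjk, ?_⟩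
  rw [hpk, hqk]
  refine mvn_of_approx (h4 k) _ _ (θ j k hjk x) (θ j k hjk h) ?_ ?_ ?_ ?_ ?_
  · change _ * θ j k hjk pj = _
    rw [← map_mul, hx, mul_assoc, pj.mul_self]
  · change θ j k hjk qj * _ = _
    rw [← map_mul, hx, ← mul_assoc, ← mul_assoc, qj.mul_self]
  · change _ = θ j k hjk pj - _
    rw [← map_four_mul, hh4, map_sub, map_mul, map_star]
  · have : ‖θ j k hjk h‖ ≤ ‖θ j k₁ hk₁ h‖ := by rw [← m1]; exact n1'
    change ‖θ j k₁ hk₁ h‖ < ‖η j h‖ + 1 / 16 at n1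
    linarith
  · change ‖θ j k hjk qj - _‖ < 1
    rw [← map_star, ← map_mul, ← map_sub, ← m2]
    exact n2.trans_le (by linarith)

/-- Every projection is equivalent to one that comes from a finite stage. -/
theorem IsNormColimit.exists_mvn_lift (H : IsNormColimit (fun i j h => θ i j h) (fun i => η i))
    (h4' : IsUnit (4 : R')) (p : Proj R') :
    ∃ (i : I) (q : Proj (R i)), MvN (q.map (η i)) p := by
  obtain ⟨c, hc⟩ := h4'.exists_right_inv
  have c1 : Continuous fun q : R' => c * (p - star (q * p : R') * (q * p) : R') := by fun_prop
  have c2 : Continuous fun q : R' => (q - (q * p) * star (q * p : R') : R') := by fun_prop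
  have t1 := c1.tendsto p
  have t2 := c2.tendsto p
  rw [p.mul_self, p.star_self, p.mul_self, sub_self, mul_zero] at t1
  rw [p.mul_self, p.star_self, p.mul_self, sub_self] at t2
  -- This is the formula of `exists_proj_near` for the corrected projection, with `a = b.1^* b.1`
  -- and correction `b.2`; its value at `(p, 0)` is `p`.
  have c3 : Continuous fun b : R' × R' =>
      star b.1 * b.1 - (b.2 - 2 * (star b.1 * b.1 * b.2)) := by fun_prop
  have c4 : Continuous fun b : R' => star b * b - star b * b * (star b * b) := by fun_prop
  have t3 := c3.tendsto ((p : R'), 0)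
  have t4 := c4.tendsto p
  simp only [p.star_self, p.mul_self, sub_self, mul_zero, sub_zero] at t3 t4
  obtain ⟨δ, hδ, hball⟩ := Metric.eventually_nhds_iff.1 (t3.eventually
    ((t1.eventually (Metric.ball_mem_nhds _ (by norm_num : (0 : ℝ) < 1 / 8))).and
      (t2.eventually (Metric.ball_mem_nhds _ (by norm_num : (0 : ℝ) < 1)))))
  -- This tolerance is spent twice, once for the approximation in the limit and once for the passage
  -- to a finite stage. Doubled, it is at most `1 / 8`, as `exists_proj_near` demands, and at most
  -- `δ / 8`, so that the correction has norm at most `4 (δ / 8) < δ`.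
  have hδ' : 0 < min (1 / 16) (δ / 16) := by positivity
  obtain ⟨γ, hγ, hball'⟩ := Metric.eventually_nhds_iff.1
    (t4.eventually (Metric.ball_mem_nhds _ hδ'))
  obtain ⟨i, y, hy⟩ := H.dense p (min γ δ) (by positivity)
  have b0 := hball' (y := η i y) (by rw [dist_eq_norm]; exact hy.trans_le (min_le_left _ _))
  rw [dist_zero_right] at b0
  obtain ⟨j, hij, n⟩ := H.exists_norm_lt i (star y * y - star y * y * (star y * y)) _ hδ'
  have e1 : η i (star y * y - star y * y * (star y * y)) =
      star (η i y) * η i y - star (η i y) * η i y * (star (η i y) * η i y) := by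
    simp only [map_sub, map_mul, map_star]
  rw [← e1] at b0
  have n' : ‖θ i j hij (star y * y - star y * y * (star y * y))‖ <
      min (1 / 16) (δ / 16) + min (1 / 16) (δ / 16) :=
    lt_trans n (add_lt_add_left b0 _)
  simp only [map_sub, map_mul, map_star] at n'
  have hηy : η j (θ i j hij y) = η i y := H.comp _ _ hij y
  generalize θ i j hij y = w at n' hηy
  rw [← hηy] at hy
  have m1 := min_le_left (1 / 16 : ℝ) (δ / 16)
  have m2 := min_le_right (1 / 16 : ℝ) (δ / 16)
  -- An approximant `w` of `p` need not be self-adjoint; `w^* w` is, and it still approximates `p^*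
  -- p = p`.
  obtain ⟨q, z, hq, hz⟩ := exists_proj_near (star w * w) (by rw [star_mul, star_star])
    (by linarith)
  have hηz : ‖η j z‖ < δ := (H.norm_le j z).trans_lt (by linarith)
  have hηq : η j q = star (η j w) * η j w - (η j z - 2 * (star (η j w) * η j w * η j z)) := by
    rw [hq]
    simp only [two_mul, map_sub, map_mul, map_star, map_add]
  obtain ⟨b1, b2⟩ := hball (y := (η j w, η j z)) (by
    rw [Prod.dist_eq]
    refine max_lt ?_ ?_
    · rw [dist_eq_norm]; exact hy.trans_le (min_le_right _ _)
    · rwa [dist_zero_right])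
  rw [dist_zero_right, ← hηq] at b1 b2
  refine ⟨j, q, MvN.symm ?_⟩
  -- For projections `q` near `p`, the product `q p` is almost a partial isometry from `p` to `q`.
  refine mvn_of_approx h4' p (q.map (η j)) (η j q * p)
    (c * (p - star (η j q * p) * (η j q * p))) ?_ ?_ ?_ b1.le b2
  · rw [mul_assoc, p.mul_self]
  · change η j q * _ = _
    rw [← mul_assoc, ← map_mul, q.mul_self]
  · rw [← mul_assoc, hc, one_mul]

end Lift

theorem completeSpace_induced {G H : Type*} [AddCommGroup G] [NormedAddCommGroup H]
    [CompleteSpace H] (f : G ≃+ H) :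
    letI := NormedAddCommGroup.induced G H f f.injective
    CompleteSpace G := by
  let _ := NormedAddCommGroup.induced G H f f.injective
  have hf : IsUniformInducing f := ⟨rfl⟩
  exact (hf.completeSpace_congr f.surjective).2 inferInstance

/-- Only `‖u‖ ≤ 1` is available in general: `E` may be the zero algebra, where unitaries have norm
`0`. -/
theorem norm_unitary_smul_le {E A : Type*} [CommCStarAlgebra E] [NormedRing A] [Algebra E A]
    [IsBoundedSMul E A] (u : unitary E) (a : A) : ‖(u : E) • a‖ ≤ ‖a‖ := by
  refine (norm_smul_le _ _).trans ?_
  have h : ‖(u : E)‖ ≤ 1 := by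
    rcases subsingleton_or_nontrivial E with hE | hE
    · rw [Subsingleton.elim (u : E) 0, norm_zero]
      exact zero_le_one
    · exact (CStarRing.norm_of_mem_unitary u.2).le
  exact mul_le_of_le_one_left (norm_nonneg _) h

/-- The scalar `4` is invertible in `ℂ`, and `A` is an algebra over the complex algebra `E`. The
Banach `*`-rings above carry no scalars, so this invertibility is passed to them as a hypothesis. -/
theorem isUnit_four_of_algebra {E A : Type*} [CommCStarAlgebra E] [Ring A] [Algebra E A] :
    IsUnit (4 : A) := by
  have h : IsUnit (4 : ℂ) := by simp
  have := (h.map (algebraMap ℂ E)).map (algebraMap E A)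
  rwa [map_ofNat, map_ofNat] at this

/-! ### The `ℓ¹`-norm on the algebra of a level -/

namespace SchurSystem

variable {T E : Type*} [Group T] [CommCStarAlgebra E] (S : SchurSystem T E)

variable {A : Type*} [NormedRing A] [StarRing A] [Algebra E A] [StarModule E A]

/-- The coefficients as an element of an `ℓ¹`-space. -/
noncomputable def coeffEquiv (n : ℕ) : S.Alg A n ≃+ PiLp 1 fun _ : S.Tn n => A where
  toFun M := WithLp.toLp 1 (S.coeff M)
  invFun X := S.ofCoeff n (WithLp.ofLp X)
  left_inv M := S.ofCoeff_coeff M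
  right_inv _ := congrArg (WithLp.toLp 1) (S.coeff_ofCoeff n _)
  map_add' _ _ := rfl

noncomputable instance instNormedAddCommGroupAlg (n : ℕ) : NormedAddCommGroup (S.Alg A n) :=
  NormedAddCommGroup.induced _ _ (S.coeffEquiv n) (S.coeffEquiv n).injective

theorem norm_alg_def {n : ℕ} (M : S.Alg A n) : ‖M‖ = ∑ t, ‖S.coeff M t‖ := by
  change ‖WithLp.toLp 1 (S.coeff M)‖ = _
  rw [PiLp.norm_eq_of_L1]

variable [IsBoundedSMul E A]

/-- The product is a convolution twisted by unitaries, which act contractively, so the usual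
`ℓ¹`-estimate for group algebras applies. -/
noncomputable instance instNormedRingAlg (n : ℕ) : NormedRing (S.Alg A n) where
  __ := S.instRingAlg A n
  __ := S.instNormedAddCommGroupAlg n
  norm_mul_le M N := by
    rw [norm_alg_def, norm_alg_def, norm_alg_def, Finset.sum_mul_sum]
    calc ∑ t, ‖S.coeff (M * N) t‖
        ≤ ∑ t : S.Tn n, ∑ u : S.Tn n, ‖S.coeff M u‖ * ‖S.coeff N (u⁻¹ * t)‖ := by
          refine Finset.sum_le_sum fun t _ => ?_
          rw [coeff_mul, conv]
          refine (norm_sum_le _ _).trans (Finset.sum_le_sum fun u _ => ?_)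
          exact (norm_unitary_smul_le _ _).trans (norm_mul_le _ _)
      _ = ∑ u, ∑ t, ‖S.coeff M u‖ * ‖S.coeff N t‖ := by
          rw [Finset.sum_comm]
          refine Finset.sum_congr rfl fun u _ => ?_
          exact Fintype.sum_equiv (Equiv.mulLeft u⁻¹) _ _ fun t => rfl

instance instNormedStarGroupAlg [NormedStarGroup A] (n : ℕ) : NormedStarGroup (S.Alg A n) where
  norm_star_le M := by
    rw [norm_alg_def, norm_alg_def]
    calc ∑ t, ‖S.coeff (star M) t‖ ≤ ∑ t, ‖S.coeff M t⁻¹‖ := by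
          refine Finset.sum_le_sum fun t _ => ?_
          rw [coeff_star, adj]
          refine (norm_unitary_smul_le (star (S.f (t : T)⁻¹ t)) _).trans ?_
          rw [norm_star]
      _ = ∑ t, ‖S.coeff M t‖ := Fintype.sum_equiv (Equiv.inv _) _ _ fun t => rfl

instance instCompleteSpaceAlg [CompleteSpace A] (n : ℕ) : CompleteSpace (S.Alg A n) :=
  @completeSpace_induced (S.Alg A n) _ (S.instRingAlg A n).toAddCommGroup _ _ (S.coeffEquiv n)

end SchurSystem

/-! ### Finite families in a norm colimit -/

section Finite

variable {I : Type*} [Preorder I] [IsDirectedOrder I] [Nonempty I] {X : I → Type*} {Y : Type*}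
    [∀ i, NormedAddCommGroup (X i)] [NormedAddCommGroup Y] {θ : ∀ i j, i ≤ j → X i → X j}
    {η : ∀ i, X i → Y}

/-- Since the transition maps are contractions, a norm bound that holds at one stage persists at all
later ones; finitely many bounds can therefore be collected by directedness. -/
theorem IsNormColimit.exists_forall_norm_lt (H : IsNormColimit θ η) {ι : Type*} (s : Finset ι)
    (i : I) (x : ι → X i) (ε : ℝ) (hε : 0 < ε) :
    ∃ (j : I) (h : i ≤ j), ∀ t ∈ s, ‖θ i j h (x t)‖ < ‖η i (x t)‖ + ε := by
  classical
  induction s using Finset.induction_on with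
  | empty => exact ⟨i, le_rfl, by simp⟩
  | insert a s ha ih =>
    obtain ⟨j, hj, hs⟩ := ih
    obtain ⟨k, hk, hk'⟩ := H.exists_norm_lt i (x a) ε hε
    obtain ⟨l, hjl, hkl⟩ := exists_ge_ge j k
    refine ⟨l, hj.trans hjl, fun t ht => ?_⟩
    rcases Finset.mem_insert.1 ht with rfl | ht
    · rw [← H.map_map i k l hk hkl]
      exact (H.norm_map_le _ _ _ _).trans_lt hk'
    · rw [← H.map_map i j l hj hjl]
      exact (H.norm_map_le _ _ _ _).trans_lt (hs t ht)

theorem IsNormColimit.exists_forall_norm_sub_lt (H : IsNormColimit θ η) {ι : Type*} (s : Finset ι)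
    (y : ι → Y) (ε : ℝ) (hε : 0 < ε) :
    ∃ (i : I) (x : ι → X i), ∀ t ∈ s, ‖η i (x t) - y t‖ < ε := by
  classical
  have key : ∃ i : I, ∀ t ∈ s, ∃ x : X i, ‖η i x - y t‖ < ε := by
    induction s using Finset.induction_on with
    | empty => exact ⟨Classical.arbitrary I, by simp⟩
    | insert a s ha ih =>
      obtain ⟨j, hs⟩ := ih
      obtain ⟨k, x, hx⟩ := H.dense (y a) ε hε
      obtain ⟨l, hjl, hkl⟩ := exists_ge_ge j k
      refine ⟨l, fun t ht => ?_⟩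
      rcases Finset.mem_insert.1 ht with rfl | ht
      · exact ⟨θ k l hkl x, by rwa [H.comp]⟩
      · obtain ⟨x, hx⟩ := hs t ht
        exact ⟨θ j l hjl x, by rwa [H.comp]⟩
  obtain ⟨i, hi⟩ := key
  choose x hx using hi
  obtain ⟨z⟩ : Nonempty (X i) := ⟨0⟩
  -- The value `z` off `s` plays no role; it only makes the family total.
  refine ⟨i, fun t => if ht : t ∈ s then x t ht else z, fun t ht => ?_⟩
  simp only [dif_pos ht]
  exact hx t ht

end Finite

/-! ### The norm of the unitization -/

section UnitizationNorm

variable {E F G : Type*} [CommCStarAlgebra E] [NonUnitalCStarAlgebra F] [ECStarAlgebra E F]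

instance instIsBoundedSMulEC : IsBoundedSMul E F :=
  IsBoundedSMul.of_norm_smul_le fun α x => ECStarAlgebra.norm_smul_le α x

variable (E F) in
/-- The unitization as an `ℓ¹`-sum. -/
noncomputable def unitizationEquiv : Unitization E F ≃+ WithLp 1 (E × F) where
  toFun x := WithLp.toLp 1 (x.fst, x.snd)
  invFun x := Unitization.inl (WithLp.ofLp x).1 + Unitization.inr (WithLp.ofLp x).2
  left_inv x := Unitization.inl_fst_add_inr_snd_eq x
  right_inv x := by
    obtain ⟨a, b⟩ := x
    simp
  map_add' x y := rfl

noncomputable instance instNormedAddCommGroupUnitization :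
    NormedAddCommGroup (Unitization E F) :=
  NormedAddCommGroup.induced _ _ (unitizationEquiv E F) (unitizationEquiv E F).injective

theorem norm_unitization_def (x : Unitization E F) : ‖x‖ = ‖x.fst‖ + ‖x.snd‖ := by
  change ‖WithLp.toLp 1 (x.fst, x.snd)‖ = _
  rw [WithLp.prod_norm_eq_of_L1]
  rfl

/-- Expanding `(‖α‖ + ‖x‖) (‖β‖ + ‖y‖)` gives one term for each of the four products that occur in
`(α, x) (β, y)`. -/
noncomputable instance instNormedRingUnitization : NormedRing (Unitization E F) where
  __ := (inferInstance : Ring (Unitization E F))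
  __ := instNormedAddCommGroupUnitization (E := E) (F := F)
  norm_mul_le x y := by
    rw [norm_unitization_def, norm_unitization_def, norm_unitization_def, Unitization.fst_mul,
      Unitization.snd_mul]
    have h1 := norm_mul_le x.fst y.fst
    have h2 := norm_add₃_le (a := x.fst • y.snd) (b := y.fst • x.snd) (c := x.snd * y.snd)
    have h3 := ECStarAlgebra.norm_smul_le x.fst y.snd
    have h4 := ECStarAlgebra.norm_smul_le y.fst x.snd
    have h5 := norm_mul_le x.snd y.snd
    linarith

instance instNormedStarGroupUnitization : NormedStarGroup (Unitization E F) where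
  norm_star_le x := by
    rw [norm_unitization_def, norm_unitization_def, Unitization.fst_star, Unitization.snd_star,
      norm_star, norm_star]

instance instCompleteSpaceUnitization : CompleteSpace (Unitization E F) :=
  completeSpace_induced (unitizationEquiv E F)

instance instIsBoundedSMulUnitization : IsBoundedSMul E (Unitization E F) :=
  IsBoundedSMul.of_norm_smul_le fun α x => by
    rw [norm_unitization_def, norm_unitization_def, Unitization.fst_smul, Unitization.snd_smul,
      mul_add]
    exact add_le_add (norm_mul_le _ _) (ECStarAlgebra.norm_smul_le _ _)

end UnitizationNorm

/-! ### Norm colimits pass to the algebra of a level -/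

namespace SchurSystem

variable {T E : Type*} [Group T] [CommCStarAlgebra E] (S : SchurSystem T E)
  {I : Type*} [Preorder I] [IsDirectedOrder I] [Nonempty I] {A : I → Type*} {B : Type*}
  [∀ i, NormedRing (A i)] [∀ i, StarRing (A i)] [∀ i, Algebra E (A i)] [∀ i, StarModule E (A i)]
  [∀ i, IsBoundedSMul E (A i)] [NormedRing B] [StarRing B] [Algebra E B] [StarModule E B]
  [IsBoundedSMul E B] {θ : ∀ i j, i ≤ j → A i →⋆ₐ[E] A j} {η : ∀ i, A i →⋆ₐ[E] B}

/-- `mapAlg` as a homomorphism of involutive rings. -/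
noncomputable def mapAlgHom {A B : Type*} [Ring A] [StarRing A] [Algebra E A] [StarModule E A]
    [Ring B] [StarRing B] [Algebra E B] [StarModule E B] (φ : A →⋆ₐ[E] B) (n : ℕ) :
    S.Alg A n →⋆ₙ+* S.Alg B n where
  toFun := S.mapAlg φ n
  map_mul' := map_mul _
  map_zero' := map_zero _
  map_add' := map_add _
  map_star' := map_star _

theorem coeff_mapAlgHom {A B : Type*} [Ring A] [StarRing A] [Algebra E A] [StarModule E A] [Ring B]
    [StarRing B] [Algebra E B] [StarModule E B] (φ : A →⋆ₐ[E] B) (n : ℕ) (x : S.Alg A n)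
    (t : S.Tn n) : S.coeff (S.mapAlgHom φ n x) t = φ (S.coeff x t) := S.coeff_mapAlg φ n x t

/-- The induced maps act coefficientwise and `T_n` is finite, so each condition is checked on the
coefficients, with the tolerance `ε` shared equally among the elements of `T_n`. These form a
nonempty set, which keeps the summed inequalities strict. -/
theorem isNormColimit_alg (H : IsNormColimit (fun i j h => θ i j h) (fun i => η i)) (n : ℕ) :
    IsNormColimit (fun i j h => S.mapAlgHom (θ i j h) n) (fun i => S.mapAlgHom (η i) n) where
  map_map i j k hij hjk x := S.coeff_injective <| funext fun t => by
    have := H.map_map i j k hij hjk (S.coeff x t)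
    simpa only [coeff_mapAlgHom] using this
  comp i j h x := S.coeff_injective <| funext fun t => by
    have := H.comp i j h (S.coeff x t)
    simpa only [coeff_mapAlgHom] using this
  norm_map_le i j h x := by
    rw [norm_alg_def, norm_alg_def]
    refine Finset.sum_le_sum fun t _ => ?_
    change ‖S.coeff (S.mapAlg (θ i j h) n x) t‖ ≤ _
    rw [coeff_mapAlg]
    exact H.norm_map_le i j h _
  norm_le i x := by
    rw [norm_alg_def, norm_alg_def]
    refine Finset.sum_le_sum fun t _ => ?_
    change ‖S.coeff (S.mapAlg (η i) n x) t‖ ≤ _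
    rw [coeff_mapAlg]
    exact H.norm_le i _
  dense y ε hε := by
    obtain ⟨i, x, hx⟩ := H.exists_forall_norm_sub_lt Finset.univ (S.coeff y)
      (ε / Fintype.card (S.Tn n)) (by positivity)
    refine ⟨i, S.ofCoeff n x, ?_⟩
    rw [norm_alg_def]
    calc ∑ t, ‖S.coeff (S.mapAlg (η i) n (S.ofCoeff n x) - y) t‖
        = ∑ t, ‖η i (x t) - S.coeff y t‖ := by
          refine Finset.sum_congr rfl fun t _ => ?_
          have : S.coeff (S.mapAlg (η i) n (S.ofCoeff n x) - y) t =
            S.coeff (S.mapAlg (η i) n (S.ofCoeff n x)) t - S.coeff y t := rfl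
          rw [this, coeff_mapAlg, coeff_ofCoeff]
      _ < ∑ t : S.Tn n, ε / Fintype.card (S.Tn n) :=
          Finset.sum_lt_sum_of_nonempty Finset.univ_nonempty hx
      _ = ε := by
          rw [Finset.sum_const, Finset.card_univ, nsmul_eq_mul]
          field_simp
  exists_norm_lt i x ε hε := by
    obtain ⟨j, h, hx⟩ := H.exists_forall_norm_lt Finset.univ i (S.coeff x)
      (ε / Fintype.card (S.Tn n)) (by positivity)
    refine ⟨j, h, ?_⟩
    rw [norm_alg_def, norm_alg_def]
    calc ∑ t, ‖S.coeff (S.mapAlg (θ i j h) n x) t‖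
        = ∑ t, ‖θ i j h (S.coeff x t)‖ := by simp only [coeff_mapAlg]
      _ < ∑ t, (‖η i (S.coeff x t)‖ + ε / Fintype.card (S.Tn n)) :=
          Finset.sum_lt_sum_of_nonempty Finset.univ_nonempty hx
      _ = ∑ t, ‖S.coeff (S.mapAlg (η i) n x) t‖ + ε := by
          rw [Finset.sum_add_distrib, Finset.sum_const, Finset.card_univ, nsmul_eq_mul]
          simp only [coeff_mapAlg]
          field_simp

end SchurSystem

/-! ### Norm colimits pass to unitizations -/

section Unitization

variable {E : Type*} [CommCStarAlgebra E] {I : Type*} [Preorder I] {F : I → Type*}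
  [∀ i, NonUnitalCStarAlgebra (F i)] [∀ i, ECStarAlgebra E (F i)]
  {φ : ∀ i j, i ≤ j → F i →⋆ₙₐ[E] F j} {L : Type*} [NonUnitalCStarAlgebra L] [ECStarAlgebra E L]
  {ι : ∀ i, F i →⋆ₙₐ[E] L}

theorem fst_checkMap {F G : Type*} [NonUnitalCStarAlgebra F] [ECStarAlgebra E F]
    [NonUnitalCStarAlgebra G] [ECStarAlgebra E G] (φ : F →⋆ₙₐ[E] G) (x : Unitization E F) :
    (checkMap φ x).fst = x.fst := by
  induction x using Unitization.ind with
  | inl_add_inr a b =>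
    rw [map_add]
    simp [checkMap, Unitization.algebraMap_eq_inl]

theorem snd_checkMap {F G : Type*} [NonUnitalCStarAlgebra F] [ECStarAlgebra E F]
    [NonUnitalCStarAlgebra G] [ECStarAlgebra E G] (φ : F →⋆ₙₐ[E] G) (x : Unitization E F) :
    (checkMap φ x).snd = φ x.snd := by
  induction x using Unitization.ind with
  | inl_add_inr a b =>
    rw [map_add]
    simp [checkMap, Unitization.algebraMap_eq_inl]

/-- All the maps fix the `E`-coordinate and the norm is the sum of the two coordinate norms, so only
the second coordinate has to be approximated. -/
theorem isNormColimit_unitization (H : IsNormColimit (fun i j h => φ i j h) (fun i => ι i)) :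
    IsNormColimit (fun i j h => checkMap (φ i j h)) (fun i => checkMap (ι i)) where
  map_map i j k hij hjk x := by
    ext
    · simp only [fst_checkMap]
    · simpa only [snd_checkMap] using H.map_map i j k hij hjk x.snd
  comp i j h x := by
    ext
    · simp only [fst_checkMap]
    · simpa only [snd_checkMap] using H.comp i j h x.snd
  norm_map_le i j h x := by
    rw [norm_unitization_def, norm_unitization_def, fst_checkMap, snd_checkMap]
    gcongr
    exact H.norm_map_le i j h _
  norm_le i x := by
    rw [norm_unitization_def, norm_unitization_def, fst_checkMap, snd_checkMap]
    gcongr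
    exact H.norm_le i _
  dense y ε hε := by
    obtain ⟨i, x, hx⟩ := H.dense y.snd ε hε
    refine ⟨i, Unitization.inl y.fst + Unitization.inr x, ?_⟩
    have h1 : (checkMap (ι i) (Unitization.inl y.fst + Unitization.inr x) - y).fst = 0 := by
      refine Eq.trans (congrArg (· - y.fst) (fst_checkMap _ _)) ?_
      simp
    have h2 : (checkMap (ι i) (Unitization.inl y.fst + Unitization.inr x) - y).snd =
        ι i x - y.snd := by
      refine Eq.trans (congrArg (· - y.snd) (snd_checkMap _ _)) ?_
      simp
    rwa [norm_unitization_def, h1, h2, norm_zero, zero_add]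
  exists_norm_lt i x ε hε := by
    obtain ⟨j, h, hx⟩ := H.exists_norm_lt i x.snd ε hε
    refine ⟨j, h, ?_⟩
    rw [norm_unitization_def, norm_unitization_def, fst_checkMap, snd_checkMap, fst_checkMap,
      snd_checkMap, add_assoc]
    gcongr

end Unitization

section UnitizationAlg

variable {T E : Type*} [Group T] [CommCStarAlgebra E] (S : SchurSystem T E) {I : Type*}
  [Preorder I] [IsDirectedOrder I] [Nonempty I] {F : I → Type*}
  [∀ i, NonUnitalCStarAlgebra (F i)] [∀ i, ECStarAlgebra E (F i)]
  {φ : ∀ i j, i ≤ j → F i →⋆ₙₐ[E] F j} {L : Type*} [NonUnitalCStarAlgebra L] [ECStarAlgebra E L]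
  {ι : ∀ i, F i →⋆ₙₐ[E] L}

theorem exists_mvn_lift_alg (H : IsNormColimit (fun i j h => φ i j h) (fun i => ι i)) (n : ℕ)
    (p : Proj (S.Alg (Unitization E L) n)) :
    ∃ (i : I) (q : Proj (S.Alg (Unitization E (F i)) n)),
      MvN (q.map (S.mapAlgHom (checkMap (ι i)) n)) p :=
  (S.isNormColimit_alg (isNormColimit_unitization H) n).exists_mvn_lift
    (isUnit_four_of_algebra (E := E)) p

theorem exists_mvn_map_alg (H : IsNormColimit (fun i j h => φ i j h) (fun i => ι i)) (n : ℕ)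
    {i : I} (p q : Proj (S.Alg (Unitization E (F i)) n))
    (hpq : MvN (p.map (S.mapAlgHom (checkMap (ι i)) n)) (q.map (S.mapAlgHom (checkMap (ι i)) n))) :
    ∃ (j : I) (h : i ≤ j), MvN (p.map (S.mapAlgHom (checkMap (φ i j h)) n))
      (q.map (S.mapAlgHom (checkMap (φ i j h)) n)) :=
  (S.isNormColimit_alg (isNormColimit_unitization H) n).exists_mvn_map
    (fun _ => isUnit_four_of_algebra (E := E)) (isUnit_four_of_algebra (E := E)) p q hpq

end UnitizationAlg

open scoped ENNReal

/-! ### Bounded families modulo families that vanish asymptotically -/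

section Asymptotic

variable (E : Type*) [CommCStarAlgebra E] {I : Type*} [Preorder I] [IsDirectedOrder I] [Nonempty I]
  (F : I → Type*) [∀ i, NonUnitalCStarAlgebra (F i)] [∀ i, ECStarAlgebra E (F i)]

/-- Bounded families, to be equipped with the seminorm `limsup ‖x i‖`. -/
def BoundedFamily : Type _ := lp F ∞

namespace BoundedFamily

noncomputable instance : NonUnitalRing (BoundedFamily F) := inferInstanceAs (NonUnitalRing (lp F ∞))

noncomputable instance : StarRing (BoundedFamily F) := inferInstanceAs (StarRing (lp F ∞))

noncomputable instance : Module ℂ (BoundedFamily F) := inferInstanceAs (Module ℂ (lp F ∞))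

instance : IsScalarTower ℂ (BoundedFamily F) (BoundedFamily F) :=
  inferInstanceAs (IsScalarTower ℂ (lp F ∞) (lp F ∞))

instance : SMulCommClass ℂ (BoundedFamily F) (BoundedFamily F) :=
  inferInstanceAs (SMulCommClass ℂ (lp F ∞) (lp F ∞))

instance : StarModule ℂ (BoundedFamily F) := inferInstanceAs (StarModule ℂ (lp F ∞))

noncomputable instance : Module E (BoundedFamily F) := inferInstanceAs (Module E (lp F ∞))

instance : IsScalarTower E (BoundedFamily F) (BoundedFamily F) :=
  inferInstanceAs (IsScalarTower E (lp F ∞) (lp F ∞))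

instance : SMulCommClass E (BoundedFamily F) (BoundedFamily F) :=
  inferInstanceAs (SMulCommClass E (lp F ∞) (lp F ∞))

instance : StarModule E (BoundedFamily F) := inferInstanceAs (StarModule E (lp F ∞))

variable {F}

/-- The members of a bounded family. -/
def val (x : BoundedFamily F) (i : I) : F i :=
  let y : lp F ∞ := x
  y i

/-- A bounded family with given members. -/
def ofBound (x : ∀ i, F i) (C : ℝ) (h : ∀ i, ‖x i‖ ≤ C) : BoundedFamily F :=
  (⟨x, memℓp_infty ⟨C, by rintro _ ⟨i, rfl⟩; exact h i⟩⟩ : lp F ∞)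

theorem val_add (x y : BoundedFamily F) (i : I) : (x + y).val i = x.val i + y.val i := rfl

theorem val_neg (x : BoundedFamily F) (i : I) : (-x).val i = -x.val i := rfl

theorem val_mul (x y : BoundedFamily F) (i : I) : (x * y).val i = x.val i * y.val i := rfl

theorem val_star (x : BoundedFamily F) (i : I) : (star x).val i = star (x.val i) := rfl

theorem val_zero (i : I) : (0 : BoundedFamily F).val i = 0 := rfl

theorem ext_val {x y : BoundedFamily F} (h : ∀ i, x.val i = y.val i) : x = y :=
  lp.ext (funext h)

theorem exists_bound (x : BoundedFamily F) : ∃ C, ∀ i, ‖x.val i‖ ≤ C :=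
  ⟨_, lp.norm_apply_le_norm (p := ∞) (by simp) x⟩

variable (F) in
/-- The identity map from `lp F ∞`, which carries the supremum norm. -/
def ofLp : lp F ∞ →+ BoundedFamily F where
  toFun x := x
  map_zero' := rfl
  map_add' _ _ := rfl

/-- The eventual bounds of a family. -/
def bounds (x : BoundedFamily F) : Set ℝ := {C | 0 ≤ C ∧ ∀ᶠ i in Filter.atTop, ‖x.val i‖ ≤ C}

theorem bounds_nonempty (x : BoundedFamily F) : x.bounds.Nonempty := by
  obtain ⟨C, hC⟩ := x.exists_bound
  exact ⟨C, (norm_nonneg _).trans (hC (Classical.arbitrary I)), Filter.Eventually.of_forall hC⟩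

theorem bddBelow_bounds (x : BoundedFamily F) : BddBelow x.bounds := ⟨0, fun _ h => h.1⟩

noncomputable instance : Norm (BoundedFamily F) := ⟨fun x => sInf x.bounds⟩

theorem norm_le_of_eventually {x : BoundedFamily F} {C : ℝ} (hC : 0 ≤ C)
    (h : ∀ᶠ i in Filter.atTop, ‖x.val i‖ ≤ C) : ‖x‖ ≤ C := csInf_le x.bddBelow_bounds ⟨hC, h⟩

theorem eventually_le_of_norm_lt {x : BoundedFamily F} {C : ℝ} (h : ‖x‖ < C) :
    ∀ᶠ i in Filter.atTop, ‖x.val i‖ ≤ C := by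
  obtain ⟨D, hD, hDC⟩ := exists_lt_of_csInf_lt x.bounds_nonempty h
  exact hD.2.mono fun i hi => hi.trans hDC.le

theorem norm_nonneg' (x : BoundedFamily F) : 0 ≤ ‖x‖ := le_csInf x.bounds_nonempty fun _ h => h.1

noncomputable instance : SeminormedAddCommGroup (BoundedFamily F) :=
  AddGroupSeminorm.toSeminormedAddCommGroup
    { toFun := fun x => ‖x‖
      map_zero' := le_antisymm (norm_le_of_eventually le_rfl (by simp [val_zero]))
        (norm_nonneg' _)
      add_le' := fun x y => by
        refine le_of_forall_pos_le_add fun ε hε => ?_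
        have hx := eventually_le_of_norm_lt (lt_add_of_pos_right ‖x‖ (half_pos hε))
        have hy := eventually_le_of_norm_lt (lt_add_of_pos_right ‖y‖ (half_pos hε))
        have h0 := norm_nonneg' x
        have h1 := norm_nonneg' y
        refine norm_le_of_eventually (by positivity) ?_
        filter_upwards [hx, hy] with i h2 h3
        rw [val_add]
        linarith [norm_add_le (x.val i) (y.val i)]
      neg' := fun x => by
        change sInf _ = sInf _
        simp only [bounds, val_neg, norm_neg] }

noncomputable instance : NonUnitalSeminormedRing (BoundedFamily F) where
  __ := (inferInstance : NonUnitalRing (BoundedFamily F))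
  __ := (inferInstance : SeminormedAddCommGroup (BoundedFamily F))
  norm_mul_le x y := by
    have h0 := norm_nonneg' x
    have h1 := norm_nonneg' y
    refine le_mul_of_forall_lt₀ fun a ha b hb => ?_
    refine norm_le_of_eventually (mul_nonneg (h0.trans ha.le) (h1.trans hb.le)) ?_
    filter_upwards [eventually_le_of_norm_lt ha, eventually_le_of_norm_lt hb] with i h2 h3
    exact (norm_mul_le _ _).trans (mul_le_mul h2 h3 (norm_nonneg _) (h0.trans ha.le))

/-- The C*-identity in each `F i` turns an eventual bound `C` for `x^* x` into the eventual bound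
`√C` for `x`. -/
theorem norm_star_mul_self_ge (x : BoundedFamily F) : ‖x‖ * ‖x‖ ≤ ‖star x * x‖ := by
  refine le_of_forall_gt_imp_ge_of_dense fun C hC => ?_
  have hC0 : 0 ≤ C := (norm_nonneg' _).trans hC.le
  have h : ‖x‖ ≤ √C := by
    refine norm_le_of_eventually (Real.sqrt_nonneg _) ?_
    filter_upwards [eventually_le_of_norm_lt hC] with i hi
    rw [val_mul, val_star, CStarRing.norm_star_mul_self] at hi
    exact Real.le_sqrt_of_sq_le (by rwa [sq])
  calc ‖x‖ * ‖x‖ ≤ √C * √C := mul_self_le_mul_self (norm_nonneg' x) h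
    _ = C := Real.mul_self_sqrt hC0

theorem norm_le_mul_of_forall {x y : BoundedFamily F} {c : ℝ} (hc : 0 ≤ c)
    (h : ∀ i, ‖y.val i‖ ≤ c * ‖x.val i‖) : ‖y‖ ≤ c * ‖x‖ := by
  have h0 := norm_nonneg' x
  refine le_mul_of_forall_lt₀ fun a ha b hb => ?_
  refine norm_le_of_eventually (mul_nonneg (hc.trans ha.le) (h0.trans hb.le)) ?_
  filter_upwards [eventually_le_of_norm_lt hb] with i hi
  exact (h i).trans (mul_le_mul ha.le hi (norm_nonneg _) (hc.trans ha.le))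

theorem norm_star_le (x : BoundedFamily F) : ‖star x‖ ≤ ‖x‖ := by
  have := norm_le_mul_of_forall (x := x) (y := star x) zero_le_one fun i => by
    rw [val_star, norm_star, one_mul]
  rwa [one_mul] at this

noncomputable instance : NormedSpace ℂ (BoundedFamily F) where
  norm_smul_le c x := norm_le_mul_of_forall (norm_nonneg c) fun i => norm_smul_le c (x.val i)

instance : IsBoundedSMul E (BoundedFamily F) :=
  IsBoundedSMul.of_norm_smul_le fun c x =>
    norm_le_mul_of_forall (norm_nonneg c) fun i => norm_smul_le c (x.val i)

theorem norm_ofLp_le (x : lp F ∞) : ‖ofLp F x‖ ≤ ‖x‖ :=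
  norm_le_of_eventually (norm_nonneg _)
    (Filter.Eventually.of_forall (lp.norm_apply_le_norm (p := ∞) (by simp) x))

/-- A family can be changed on an initial part so that its supremum norm is almost its seminorm. -/
theorem exists_lp_norm_le (x : BoundedFamily F) {C : ℝ} (hC : ‖x‖ < C) :
    ∃ y : lp F ∞, ‖y‖ ≤ C ∧ ‖x - ofLp F y‖ = 0 := by
  classical
  have h0 : 0 ≤ C := (norm_nonneg' x).trans hC.le
  have hy : ∀ i, ‖(if ‖x.val i‖ ≤ C then x.val i else 0)‖ ≤ C := fun i => by
    split_ifs with h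
    · exact h
    · rwa [norm_zero]
  refine ⟨ofBound _ C hy, lp.norm_le_of_forall_le h0 hy, le_antisymm ?_ (norm_nonneg' _)⟩
  refine norm_le_of_eventually le_rfl ?_
  filter_upwards [eventually_le_of_norm_lt hC] with i hi
  change ‖x.val i - (if ‖x.val i‖ ≤ C then x.val i else 0)‖ ≤ 0
  rw [if_pos hi, sub_self, norm_zero]

end BoundedFamily

/-- Bounded families modulo the families `x` with `limsup ‖x i‖ = 0`. -/
abbrev AsymptoticAlgebra : Type _ := SeparationQuotient (BoundedFamily F)

namespace AsymptoticAlgebra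

open SeparationQuotient

variable {F}

noncomputable instance : StarRing (AsymptoticAlgebra F) where
  star := SeparationQuotient.lift (fun x => mk (star x)) fun x y hxy => by
    rw [Metric.inseparable_iff, dist_eq_norm] at hxy
    rw [mk_eq_mk, Metric.inseparable_iff, dist_eq_norm, ← star_sub]
    exact le_antisymm ((BoundedFamily.norm_star_le _).trans hxy.le) (norm_nonneg _)
  star_involutive := by
    rintro ⟨x⟩
    exact congrArg mk (star_star x)
  star_mul := by
    rintro ⟨x⟩ ⟨y⟩
    exact congrArg mk (star_mul x y)
  star_add := by
    rintro ⟨x⟩ ⟨y⟩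
    exact congrArg mk (star_add x y)

/-- An absolutely summable series lifts to an absolutely summable series in the complete space `lp F
∞`: representatives can be chosen whose supremum norm exceeds the quotient norm by at most `(1 / 2)
^ n`. The map back to the quotient is contractive, so it carries the sum to a limit. -/
instance : CompleteSpace (AsymptoticAlgebra F) := by
  refine NormedAddCommGroup.completeSpace_of_summable_imp_tendsto fun u hu => ?_
  have hlift : ∀ n, ∃ y : lp F ∞, ‖y‖ ≤ ‖u n‖ + (1 / 2) ^ n ∧
      (mk (BoundedFamily.ofLp F y) : AsymptoticAlgebra F) = u n := by
    intro n
    obtain ⟨x, hx⟩ := surjective_mk (u n)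
    have hlt : ‖x‖ < ‖u n‖ + (1 / 2) ^ n := by
      rw [← hx, norm_mk]
      exact lt_add_of_pos_right _ (by positivity)
    obtain ⟨y, hy, hxy⟩ := BoundedFamily.exists_lp_norm_le x hlt
    refine ⟨y, hy, ?_⟩
    rw [← hx, eq_comm, mk_eq_mk, Metric.inseparable_iff, dist_eq_norm]
    exact hxy
  choose y hy hyu using hlift
  have hs : Summable y := Summable.of_norm_bounded (hu.add summable_geometric_two) hy
  obtain ⟨a, ha⟩ := hs
  refine ⟨mk (BoundedFamily.ofLp F a), ?_⟩
  have ha' := ha.tendsto_sum_nat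
  rw [tendsto_iff_norm_sub_tendsto_zero] at ha' ⊢
  refine squeeze_zero (fun _ => norm_nonneg _) (fun n => ?_) ha'
  have : ∑ i ∈ Finset.range n, u i - mk (BoundedFamily.ofLp F a) =
      mk (BoundedFamily.ofLp F (∑ i ∈ Finset.range n, y i - a)) := by
    have h := map_sum ((mkAddMonoidHom (M := BoundedFamily F)).comp (BoundedFamily.ofLp F)) y
      (Finset.range n)
    simp only [AddMonoidHom.comp_apply, mkAddMonoidHom_apply, hyu] at h
    rw [map_sub, mk_sub, h]
  rw [this, norm_mk]
  exact BoundedFamily.norm_ofLp_le _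

noncomputable instance : NonUnitalCStarAlgebra (AsymptoticAlgebra F) where
  __ := (inferInstance : NonUnitalNormedRing (AsymptoticAlgebra F))
  __ := (inferInstance : NormedSpace ℂ (AsymptoticAlgebra F))
  __ := (inferInstance : StarRing (AsymptoticAlgebra F))
  __ := (inferInstance : CompleteSpace (AsymptoticAlgebra F))
  norm_mul_self_le := by
    rintro ⟨x⟩
    exact BoundedFamily.norm_star_mul_self_ge x
  smul_assoc := by
    rintro c ⟨x⟩ ⟨y⟩
    exact congrArg mk (smul_assoc c x y)
  smul_comm := by
    rintro c ⟨x⟩ ⟨y⟩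
    exact congrArg mk (smul_comm c x y)
  star_smul := by
    rintro c ⟨x⟩
    exact congrArg mk (star_smul c x)

noncomputable instance : ECStarAlgebra E (AsymptoticAlgebra F) where
  __ := (inferInstance : Module E (AsymptoticAlgebra F))
  smul_assoc := by
    rintro c ⟨x⟩ ⟨y⟩
    exact congrArg mk (smul_assoc c x y)
  smul_comm := by
    rintro c ⟨x⟩ ⟨y⟩
    exact congrArg mk (smul_comm c x y)
  star_smul := by
    rintro c ⟨x⟩
    exact congrArg mk (star_smul c x)
  smul_assoc_complex := by
    rintro c α ⟨x⟩
    exact congrArg mk (BoundedFamily.ext_val fun i =>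
      ECStarAlgebra.smul_assoc_complex c α (x.val i))
  norm_smul_le := by
    rintro α ⟨x⟩
    exact norm_smul_le α x

end AsymptoticAlgebra

end Asymptotic

/-! ### Contractivity of `E`-linear `*`-homomorphisms -/

section Contraction

variable {E F G : Type*} [CommCStarAlgebra E] [NonUnitalCStarAlgebra F] [ECStarAlgebra E F]
  [NonUnitalCStarAlgebra G] [ECStarAlgebra E G]

theorem complex_smul_eq (c : ℂ) (x : F) : c • x = (c • (1 : E)) • x := by
  rw [ECStarAlgebra.smul_assoc_complex, one_smul]

/-- Complex scalars act through `c • 1` in `E`, so `E`-linearity implies complex linearity, and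
`*`-homomorphisms between C*-algebras are contractive. -/
theorem norm_hom_le (φ : F →⋆ₙₐ[E] G) (x : F) : ‖φ x‖ ≤ ‖x‖ := by
  let ψ : F →⋆ₙₐ[ℂ] G :=
    { φ with
      map_smul' := fun c y => by
        change φ (c • y) = c • φ y
        rw [complex_smul_eq (E := E) c y, complex_smul_eq (E := E) c (φ y), map_smul] }
  exact NonUnitalStarAlgHom.norm_apply_le ψ x

end Contraction

/-! ### Inductive limits are norm colimits -/

section InductiveLimit

variable {E : Type w} [CommCStarAlgebra E] {I : Type v} [Preorder I] [IsDirectedOrder I]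
  [Nonempty I]
  {F : I → Type u} [∀ i, NonUnitalCStarAlgebra (F i)] [∀ i, ECStarAlgebra E (F i)]
  (φ : ∀ i j, i ≤ j → F i →⋆ₙₐ[E] F j) [DirectedSystem F fun i j h => φ i j h]

/-- The canonical maps into the algebra of asymptotic families. -/
noncomputable def toAsymptotic (i : I) : F i →⋆ₙₐ[E] AsymptoticAlgebra F := by
  classical
  exact
  -- The family is set to `0` at the indices not above `i`. The set of indices above `i` is
  -- eventual, so this choice does not affect the class.
  { toFun := fun x => SeparationQuotient.mk (BoundedFamily.ofBound
      (fun j => if h : i ≤ j then φ i j h x else 0) ‖x‖ fun j => by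
        split_ifs with h
        · exact norm_hom_le _ _
        · rw [norm_zero]; exact norm_nonneg _)
    map_smul' := fun c x => congrArg SeparationQuotient.mk <| BoundedFamily.ext_val fun j => by
      change (if h : i ≤ j then φ i j h (c • x) else 0) =
        c • (if h : i ≤ j then φ i j h x else 0)
      split_ifs with h
      · exact map_smul (φ i j h) c x
      · exact (smul_zero c).symm
    map_zero' := congrArg SeparationQuotient.mk <| BoundedFamily.ext_val fun j => by
      change (if h : i ≤ j then φ i j h 0 else 0) = 0
      split_ifs with h
      · exact map_zero (φ i j h)
      · rfl
    map_add' := fun x y => congrArg SeparationQuotient.mk <| BoundedFamily.ext_val fun j => by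
      change (if h : i ≤ j then φ i j h (x + y) else 0) =
        (if h : i ≤ j then φ i j h x else 0) + (if h : i ≤ j then φ i j h y else 0)
      split_ifs with h
      · exact map_add (φ i j h) x y
      · exact (add_zero 0).symm
    map_mul' := fun x y => congrArg SeparationQuotient.mk <| BoundedFamily.ext_val fun j => by
      change (if h : i ≤ j then φ i j h (x * y) else 0) =
        (if h : i ≤ j then φ i j h x else 0) * (if h : i ≤ j then φ i j h y else 0)
      split_ifs with h
      · exact map_mul (φ i j h) x y
      · exact (mul_zero 0).symm
    map_star' := fun x => congrArg SeparationQuotient.mk <| BoundedFamily.ext_val fun j => by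
      change (if h : i ≤ j then φ i j h (star x) else 0) =
        star (if h : i ≤ j then φ i j h x else 0)
      split_ifs with h
      · exact map_star (φ i j h) x
      · exact (star_zero _).symm }

theorem map_map_of_directedSystem {i j k : I} (hij : i ≤ j) (hjk : j ≤ k) (x : F i) :
    φ j k hjk (φ i j hij x) = φ i k (hij.trans hjk) x :=
  DirectedSystem.map_map (f := fun i j h => φ i j h) hij hjk x

/-- The two families may differ at indices not above `j`, but they agree from `j` on, so their
difference has seminorm `0`. -/
theorem toAsymptotic_comp (i j : I) (h : i ≤ j) :
    (toAsymptotic φ j).comp (φ i j h) = toAsymptotic φ i := by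
  classical
  ext x
  refine SeparationQuotient.mk_eq_mk.2 ?_
  rw [Metric.inseparable_iff, dist_eq_norm]
  refine le_antisymm (BoundedFamily.norm_le_of_eventually le_rfl ?_) (norm_nonneg _)
  filter_upwards [Filter.eventually_ge_atTop j] with k hk
  change ‖(if hjk : j ≤ k then φ j k hjk (φ i j h x) else 0) -
    (if hik : i ≤ k then φ i k hik x else 0)‖ ≤ 0
  rw [dif_pos hk, dif_pos (h.trans hk), map_map_of_directedSystem, sub_self, norm_zero]

theorem exists_norm_le_of_toAsymptotic (i : I) (x : F i) (C : ℝ) (hC : ‖toAsymptotic φ i x‖ < C) :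
    ∃ (j : I) (h : i ≤ j), ‖φ i j h x‖ ≤ C := by
  classical
  have h1 := BoundedFamily.eventually_le_of_norm_lt (F := F) hC
  obtain ⟨j, h2, h3⟩ := (h1.and (Filter.eventually_ge_atTop i)).exists
  refine ⟨j, h3, ?_⟩
  have : (if h : i ≤ j then φ i j h x else 0) = φ i j h3 x := dif_pos h3
  rw [← this]
  exact h2

variable {L : Type (max u v)} [NonUnitalCStarAlgebra L] [ECStarAlgebra E L]

theorem complex_smulMemClass (E L : Type*) [CommCStarAlgebra E] [NonUnitalCStarAlgebra L]
    [ECStarAlgebra E L] : SMulMemClass (NonUnitalStarSubalgebra E L) ℂ L where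
  smul_mem {s} c x hx := by
    rw [complex_smul_eq (E := E)]
    exact s.smul_mem _ hx

noncomputable instance {E L : Type*} [CommCStarAlgebra E] [NonUnitalCStarAlgebra L]
    [ECStarAlgebra E L] (M : NonUnitalStarSubalgebra E L) [h : IsClosed (M : Set L)] :
    NonUnitalCStarAlgebra M :=
  haveI := complex_smulMemClass E L
  NonUnitalStarSubalgebra.nonUnitalCStarAlgebra M (h_closed := h)

/-- Closed `E`-linear subalgebras of `E`-C*-algebras are `E`-C*-algebras. -/
noncomputable instance {E L : Type*} [CommCStarAlgebra E] [NonUnitalCStarAlgebra L]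
    [ECStarAlgebra E L] (M : NonUnitalStarSubalgebra E L) [IsClosed (M : Set L)] :
    ECStarAlgebra E M where
  __ := (inferInstance : Module E M)
  smul_assoc c x y := Subtype.ext (smul_assoc c (x : L) (y : L))
  smul_comm c x y := Subtype.ext (smul_comm c (x : L) (y : L))
  star_smul c x := Subtype.ext (star_smul c (x : L))
  smul_assoc_complex c α x := Subtype.ext (ECStarAlgebra.smul_assoc_complex c α (x : L))
  norm_smul_le α x := ECStarAlgebra.norm_smul_le α (x : L)

variable {φ} in
-- The cocone corestricts to `M`, hence induces a map from `L` to `M`. Followed by the inclusion it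
-- is an endomorphism of `L` compatible with the cocone, thus the identity by uniqueness, and every
-- `y` lies in `M`.
theorem IsInductiveLimit.eq_top_of_isClosed {ι : ∀ i, F i →⋆ₙₐ[E] L} (hL : IsInductiveLimit φ ι)
    (M : NonUnitalStarSubalgebra E L) (hM : IsClosed (M : Set L)) (h : ∀ i x, ι i x ∈ M) (y : L) :
    y ∈ M := by
  obtain ⟨k, hk, -⟩ := hL.existsUnique_desc M
    (fun i => NonUnitalStarAlgHom.codRestrict (ι i) M (h i))
    fun i j hij => by
      ext x
      exact DFunLike.congr_fun (hL.compat i j hij) x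
  have h1 : (NonUnitalStarSubalgebraClass.subtype M : M →⋆ₙₐ[E] L).comp k =
      NonUnitalStarAlgHom.id E L := by
    refine (hL.existsUnique_desc L ι hL.compat).unique (fun i => ?_) (fun i => ?_)
    · ext x
      exact congrArg Subtype.val (DFunLike.congr_fun (hk i) x)
    · rfl
  have h2 := DFunLike.congr_fun h1 y
  change (k y : L) = y at h2
  rw [← h2]
  exact (k y).2

variable {φ} in
theorem IsInductiveLimit.isNormColimit {ι : ∀ i, F i →⋆ₙₐ[E] L} (hL : IsInductiveLimit φ ι) :
    IsNormColimit (fun i j h => φ i j h) (fun i => ι i) where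
  map_map i j k hij hjk x := map_map_of_directedSystem φ hij hjk x
  comp i j h x := DFunLike.congr_fun (hL.compat i j h) x
  norm_map_le i j h x := norm_hom_le _ _
  norm_le i x := norm_hom_le _ _
  dense y ε hε := by
    -- The ranges form a directed family, so their supremum is their union, and an element of it is
    -- the image of an element of a single `F i`.
    let N : NonUnitalStarSubalgebra E L := ⨆ i, NonUnitalStarAlgHom.range (ι i)
    have hdir : Directed (· ≤ ·) fun i => NonUnitalStarAlgHom.range (ι i) := by
      intro i j
      obtain ⟨k, hik, hjk⟩ := exists_ge_ge i j
      refine ⟨k, ?_, ?_⟩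
      · rintro _ ⟨x, rfl⟩
        exact ⟨φ i k hik x, DFunLike.congr_fun (hL.compat i k hik) x⟩
      · rintro _ ⟨x, rfl⟩
        exact ⟨φ j k hjk x, DFunLike.congr_fun (hL.compat j k hjk) x⟩
    have hN : (N : Set L) = ⋃ i, (NonUnitalStarAlgHom.range (ι i) : Set L) :=
      NonUnitalStarSubalgebra.coe_iSup_of_directed hdir
    have hy : y ∈ N.topologicalClosure :=
      hL.eq_top_of_isClosed _ N.isClosed_topologicalClosure (fun i x =>
        N.le_topologicalClosure (le_iSup (fun i => NonUnitalStarAlgHom.range (ι i)) i ⟨x, rfl⟩)) y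
    have hy' : y ∈ closure (N : Set L) := hy
    obtain ⟨z, hz, hzy⟩ := Metric.mem_closure_iff.1 hy' ε hε
    rw [hN, Set.mem_iUnion] at hz
    obtain ⟨i, x, rfl⟩ := hz
    exact ⟨i, x, by rwa [dist_comm, dist_eq_norm] at hzy⟩
  exists_norm_lt i x ε hε := by
    -- The algebra of asymptotic families lies in the universe `max u v` of the test objects. Its
    -- norm at the image of `x` is the limsup of the norms along the system, and contractivity of
    -- `k` bounds it by `‖ι i x‖`.
    obtain ⟨k, hk, -⟩ := hL.existsUnique_desc (AsymptoticAlgebra F) (toAsymptotic φ)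
      (toAsymptotic_comp φ)
    have h1 : ‖toAsymptotic φ i x‖ ≤ ‖ι i x‖ := by
      rw [← hk i]
      exact norm_hom_le k (ι i x)
    obtain ⟨j, hij, hj⟩ := exists_norm_le_of_toAsymptotic φ i x (‖ι i x‖ + ε / 2) (by linarith)
    exact ⟨j, hij, by linarith⟩

end InductiveLimit

/-! ### Projections of the algebraic limit -/

namespace KSystem

variable {T E : Type*} [Group T] [CommCStarAlgebra E] (S : KSystem T E)

section Algebra

variable {A : Type*} [Ring A] [StarRing A] [Algebra E A] [StarModule E A]

/-- The canonical homomorphism `A_n → A_→`. -/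
noncomputable def toLimHom (A : Type*) [Ring A] [StarRing A] [Algebra E A] [StarModule E A]
    (n : ℕ) :
    S.Alg A n →⋆ₙ+* S.Lim A where
  toFun := S.toLim n
  map_mul' := S.toLim_mul n
  map_zero' := S.toLim_zero n
  map_add' := S.toLim_add n
  map_star' := S.toLim_star n

theorem toLim_rho (m n : ℕ) (h : m ≤ n) (x : S.Alg A m) : S.toLim n (S.rho m n h x) = S.toLim m x :=
  DirectLimit.mk_apply (f := fun i j h => S.rho (A := A) i j h) m n x h

theorem rho_rho {l m n : ℕ} (h : l ≤ m) (h' : m ≤ n) (x : S.Alg A l) :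
    S.rho m n h' (S.rho l m h x) = S.rho l n (h.trans h') x :=
  DirectedSystem.map_map (f := fun i j h => S.rho (A := A) i j h) h h' x

theorem exists_rho_eq_of_toLim_eq (n : ℕ) (x y : S.Alg A n) (h : S.toLim n x = S.toLim n y) :
    ∃ (m : ℕ) (hm : n ≤ m), S.rho n m hm x = S.rho n m hm y := by
  obtain ⟨m, h1, _, h2⟩ := Quotient.exact h
  exact ⟨m, h1, h2⟩

/-- `rho` as a homomorphism of involutive rings. -/
noncomputable def rhoHom (m n : ℕ) (h : m ≤ n) : S.Alg A m →⋆ₙ+* S.Alg A n where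
  toFun := S.rho m n h
  map_mul' := map_mul _
  map_zero' := map_zero _
  map_add' := map_add _
  map_star' := map_star _

theorem map_toLim_rho {m n : ℕ} (h : m ≤ n) (p : Proj (S.Alg A m)) :
    (p.map (S.rhoHom m n h)).map (S.toLimHom A n) = p.map (S.toLimHom A m) :=
  Subtype.ext (S.toLim_rho m n h (p : S.Alg A m))

/-- The relations `x * x = x` and `star x = x` hold in the limit for a representative `x`, hence
each holds after finitely many steps. A level above both turns the image of `x` into a projection.
-/
theorem exists_proj_toLim (P : Proj (S.Lim A)) :
    ∃ (n : ℕ) (p : Proj (S.Alg A n)), p.map (S.toLimHom A n) = P := by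
  obtain ⟨n, x, hx⟩ := S.exists_toLim (P : S.Lim A)
  obtain ⟨m, hm, h1⟩ := S.exists_rho_eq_of_toLim_eq n (x * x) x (by
    rw [toLim_mul, ← hx, P.mul_self])
  obtain ⟨k, hk, h2⟩ := S.exists_rho_eq_of_toLim_eq n (star x) x (by
    rw [toLim_star, ← hx, P.star_self])
  obtain ⟨l, hml, hkl⟩ := exists_ge_ge m k
  have hnl : n ≤ l := hm.trans hml
  refine ⟨l, ⟨S.rho n l hnl x, ?_, ?_⟩, Subtype.ext ?_⟩
  · change S.rho n l hnl x * S.rho n l hnl x = S.rho n l hnl x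
    rw [← map_mul, ← S.rho_rho hm hml, h1, rho_rho]
  · change star (S.rho n l hnl x) = S.rho n l hnl x
    rw [← map_star, ← S.rho_rho hk hkl, h2, rho_rho]
  · change S.toLim l (S.rho n l hnl x) = P
    rw [toLim_rho, hx]

theorem exists_proj_toLim₂ (P Q : Proj (S.Lim A)) :
    ∃ (n : ℕ) (p q : Proj (S.Alg A n)), p.map (S.toLimHom A n) = P ∧
      q.map (S.toLimHom A n) = Q := by
  obtain ⟨n, p, rfl⟩ := S.exists_proj_toLim P
  obtain ⟨m, q, rfl⟩ := S.exists_proj_toLim Q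
  obtain ⟨l, hn, hm⟩ := exists_ge_ge n m
  exact ⟨l, p.map (S.rhoHom n l hn), q.map (S.rhoHom m l hm), S.map_toLim_rho hn p,
    S.map_toLim_rho hm q⟩

/-- A partial isometry in the algebraic limit has a representative at some level, and its two
defining equations become true at a common later level. -/
theorem exists_mvn_rho {n : ℕ} (p q : Proj (S.Alg A n))
    (h : MvN (p.map (S.toLimHom A n)) (q.map (S.toLimHom A n))) :
    ∃ (m : ℕ) (hm : n ≤ m), MvN (p.map (S.rhoHom n m hm)) (q.map (S.rhoHom n m hm)) := by
  obtain ⟨z, h1, h2⟩ := h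
  obtain ⟨k, x, rfl⟩ := S.exists_toLim z
  obtain ⟨l, hnl, hkl⟩ := exists_ge_ge n k
  have e1 : S.toLim l (star (S.rho k l hkl x) * S.rho k l hkl x) = S.toLim l (S.rho n l hnl p) := by
    rw [toLim_mul, toLim_star, toLim_rho, toLim_rho]
    exact h1
  have e2 : S.toLim l (S.rho k l hkl x * star (S.rho k l hkl x)) = S.toLim l (S.rho n l hnl q) := by
    rw [toLim_mul, toLim_star, toLim_rho, toLim_rho]
    exact h2
  obtain ⟨m₁, hm₁, f1⟩ := S.exists_rho_eq_of_toLim_eq _ _ _ e1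
  obtain ⟨m₂, hm₂, f2⟩ := S.exists_rho_eq_of_toLim_eq _ _ _ e2
  obtain ⟨m, h₁, h₂⟩ := exists_ge_ge m₁ m₂
  have g1 := congrArg (S.rho m₁ m h₁) f1
  have g2 := congrArg (S.rho m₂ m h₂) f2
  simp only [rho_rho, map_mul, map_star] at g1 g2
  exact ⟨m, hnl.trans (hm₁.trans h₁), S.rho k m (hkl.trans (hm₁.trans h₁)) x, g1, g2⟩

variable {B : Type*} [Ring B] [StarRing B] [Algebra E B] [StarModule E B]

theorem map_rho_mapAlg (φ : A →⋆ₐ[E] B) {m n : ℕ} (h : m ≤ n) (p : Proj (S.Alg A m)) :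
    (p.map (S.rhoHom m n h)).map (S.mapAlgHom φ n) =
      (p.map (S.mapAlgHom φ m)).map (S.rhoHom m n h) :=
  Subtype.ext (S.mapAlg_rho φ m n h p)

theorem limMap_id (x : S.Lim A) : S.limMap (StarAlgHom.id E A) x = x := by
  obtain ⟨n, y, rfl⟩ := S.exists_toLim x
  exact congrArg (S.toLim n) (S.mapAlg_id n y)

theorem K0FullMap_id (x : S.K0Full A) : S.K0FullMap (StarAlgHom.id E A) x = x := by
  have : S.K0FullMap (StarAlgHom.id E A) = AddMonoidHom.id _ := by
    apply S.K0Full_hom_ext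
    intro P
    rw [K0FullMap_cls]
    exact congrArg S.cls (Subtype.ext (S.limMap_id (P : S.Lim A)))
  rw [this, AddMonoidHom.id_apply]

theorem K0FullMap_K0FullMap {D : Type*} [Ring D] [StarRing D] [Algebra E D] [StarModule E D]
    (ψ : B →⋆ₐ[E] D) (φ : A →⋆ₐ[E] B) (x : S.K0Full A) :
    S.K0FullMap ψ (S.K0FullMap φ x) = S.K0FullMap (ψ.comp φ) x :=
  DFunLike.congr_fun (S.K0FullMap_comp ψ φ) x

theorem K0FullMap_groth (φ : A →⋆ₐ[E] B) (a : ProjClass (S.Lim A)) :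
    S.K0FullMap φ (S.groth A a) = S.groth B (ProjClass.map (S.limMap φ) a) :=
  S.K0FullLift_groth _ _

theorem exists_groth_sub (x : S.K0Full A) : ∃ a b, x = S.groth A a - S.groth A b := by
  obtain ⟨⟨a, b⟩, h⟩ :=
    (AddLocalization.addMonoidOf (⊤ : AddSubmonoid (ProjClass (S.Lim A)))).surj x
  exact ⟨a, b, eq_sub_of_add_eq h⟩

/-- The monoid of classes need not be cancellative, hence the auxiliary summand `c`. -/
theorem groth_eq_iff (a b : ProjClass (S.Lim A)) :
    S.groth A a = S.groth A b ↔ ∃ c, c + a = c + b := by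
  refine (AddLocalization.addMonoidOf
    (⊤ : AddSubmonoid (ProjClass (S.Lim A)))).eq_iff_exists.trans ⟨?_, ?_⟩
  · rintro ⟨c, hc⟩
    exact ⟨c, hc⟩
  · rintro ⟨c, hc⟩
    exact ⟨⟨c, trivial⟩, hc⟩

theorem projClassMap_comp {D : Type*} [Ring D] [StarRing D] [Algebra E D] [StarModule E D]
    (ψ : B →⋆ₐ[E] D) (φ : A →⋆ₐ[E] B) (a : ProjClass (S.Lim A)) :
    ProjClass.map (S.limMap ψ) (ProjClass.map (S.limMap φ) a) =
      ProjClass.map (S.limMap (ψ.comp φ)) a := by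
  obtain ⟨P, rfl⟩ := a.exists_rep
  exact congrArg ProjClass.mk (Subtype.ext (S.limMap_limMap ψ φ (P : S.Lim A)))

end Algebra

end KSystem

/-! ### Continuity -/

theorem checkMap_id {E F : Type*} [CommCStarAlgebra E] [NonUnitalCStarAlgebra F]
    [ECStarAlgebra E F] (φ : F →⋆ₙₐ[E] F) (h : ∀ x, φ x = x) :
    checkMap φ = StarAlgHom.id E (Unitization E F) := by
  refine StarAlgHom.ext fun x => ?_
  change checkMap φ x = x
  ext
  · rw [fst_checkMap]
  · rw [snd_checkMap, h]

theorem checkMap_comp {E F G H : Type*} [CommCStarAlgebra E] [NonUnitalCStarAlgebra F]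
    [ECStarAlgebra E F] [NonUnitalCStarAlgebra G] [ECStarAlgebra E G] [NonUnitalCStarAlgebra H]
    [ECStarAlgebra E H] (ψ : G →⋆ₙₐ[E] H) (φ : F →⋆ₙₐ[E] G) (χ : F →⋆ₙₐ[E] H)
    (h : ∀ x, ψ (φ x) = χ x) : (checkMap ψ).comp (checkMap φ) = checkMap χ := by
  refine StarAlgHom.ext fun x => ?_
  change checkMap ψ (checkMap φ x) = checkMap χ x
  ext
  · rw [fst_checkMap, fst_checkMap, fst_checkMap]
  · rw [snd_checkMap, snd_checkMap, snd_checkMap, h]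

namespace KSystem

variable {T E : Type*} [Group T] [CommCStarAlgebra E] (S : KSystem T E)
  {I : Type*} [Preorder I] [IsDirectedOrder I] [Nonempty I] {F : I → Type*}
  [∀ i, NonUnitalCStarAlgebra (F i)] [∀ i, ECStarAlgebra E (F i)]
  {φ : ∀ i j, i ≤ j → F i →⋆ₙₐ[E] F j} {L : Type*} [NonUnitalCStarAlgebra L] [ECStarAlgebra E L]
  {ι : ∀ i, F i →⋆ₙₐ[E] L}

section

variable (H : IsNormColimit (fun i j h => φ i j h) (fun i => ι i))

include H

theorem exists_projClass_lift (a : ProjClass (S.Lim (Unitization E L))) :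
    ∃ (i : I) (b : ProjClass (S.Lim (Unitization E (F i)))),
      ProjClass.map (S.limMap (checkMap (ι i))) b = a := by
  obtain ⟨P, rfl⟩ := a.exists_rep
  obtain ⟨n, p, rfl⟩ := S.exists_proj_toLim P
  obtain ⟨i, q, hq⟩ := exists_mvn_lift_alg S.toSchurSystem H n p
  exact ⟨i, ProjClass.mk (q.map (S.toLimHom _ n)), ProjClass.sound (hq.map (S.toLimHom _ n))⟩

/-- The two limits are undone in turn: an equivalence over `L` is first brought to a level `m` of
the algebraic limit, and then, with `m` fixed, to a finite stage `j` by the norm-colimit property at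
that level. This uses that `rhoHom` commutes with `mapAlgHom`. -/
theorem exists_projClass_map_eq {i : I} (a b : ProjClass (S.Lim (Unitization E (F i))))
    (h : ProjClass.map (S.limMap (checkMap (ι i))) a =
      ProjClass.map (S.limMap (checkMap (ι i))) b) :
    ∃ (j : I) (hij : i ≤ j), ProjClass.map (S.limMap (checkMap (φ i j hij))) a =
      ProjClass.map (S.limMap (checkMap (φ i j hij))) b := by
  obtain ⟨P, rfl⟩ := a.exists_rep
  obtain ⟨Q, rfl⟩ := b.exists_rep
  obtain ⟨n, p, q, rfl, rfl⟩ := S.exists_proj_toLim₂ P Q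
  obtain ⟨m, hm, h'⟩ := S.exists_mvn_rho (p.map (S.mapAlgHom (checkMap (ι i)) n))
    (q.map (S.mapAlgHom (checkMap (ι i)) n)) (ProjClass.exact h)
  rw [← S.map_rho_mapAlg, ← S.map_rho_mapAlg] at h'
  obtain ⟨j, hij, h''⟩ := exists_mvn_map_alg S.toSchurSystem H m _ _ h'
  refine ⟨j, hij, ProjClass.sound ?_⟩
  have := h''.map (S.toLimHom _ m)
  rwa [S.map_rho_mapAlg, S.map_rho_mapAlg, S.map_toLim_rho, S.map_toLim_rho] at this

theorem checkMap_comp_checkMap {i j k : I} (hij : i ≤ j) (hjk : j ≤ k) :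
    (checkMap (φ j k hjk)).comp (checkMap (φ i j hij)) = checkMap (φ i k (hij.trans hjk)) :=
  checkMap_comp _ _ _ (H.map_map i j k hij hjk)

theorem checkMap_limit_comp {i j : I} (hij : i ≤ j) :
    (checkMap (ι j)).comp (checkMap (φ i j hij)) = checkMap (ι i) :=
  checkMap_comp _ _ _ (H.comp i j hij)

theorem exists_K0FullMap_eq (x : S.K0Full (Unitization E L)) :
    ∃ (i : I) (y : S.K0Full (Unitization E (F i))), S.K0FullMap (checkMap (ι i)) y = x := by
  obtain ⟨a, b, rfl⟩ := S.exists_groth_sub x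
  obtain ⟨i, a', rfl⟩ := S.exists_projClass_lift H a
  obtain ⟨j, b', rfl⟩ := S.exists_projClass_lift H b
  obtain ⟨k, hik, hjk⟩ := exists_ge_ge i j
  refine ⟨k, S.K0FullMap (checkMap (φ i k hik)) (S.groth _ a') -
    S.K0FullMap (checkMap (φ j k hjk)) (S.groth _ b'), ?_⟩
  rw [map_sub, K0FullMap_K0FullMap, K0FullMap_K0FullMap, checkMap_limit_comp H,
    checkMap_limit_comp H, K0FullMap_groth, K0FullMap_groth]

theorem exists_K0FullMap_eq_zero {i : I} (y : S.K0Full (Unitization E (F i)))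
    (hy : S.K0FullMap (checkMap (ι i)) y = 0) :
    ∃ (j : I) (hij : i ≤ j), S.K0FullMap (checkMap (φ i j hij)) y = 0 := by
  obtain ⟨a, b, rfl⟩ := S.exists_groth_sub y
  rw [map_sub, K0FullMap_groth, K0FullMap_groth, sub_eq_zero, groth_eq_iff] at hy
  obtain ⟨c, hc⟩ := hy
  -- The summand `c` that witnesses equality in the Grothendieck group lives over the limit. It has
  -- to be lifted too, before the equality of classes can be brought to a finite stage.
  obtain ⟨j, c', rfl⟩ := S.exists_projClass_lift H c
  obtain ⟨k, hik, hjk⟩ := exists_ge_ge i j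
  rw [← checkMap_limit_comp H hjk, ← checkMap_limit_comp H hik, ← projClassMap_comp,
    ← projClassMap_comp, ← projClassMap_comp, ← map_add, ← map_add] at hc
  obtain ⟨l, hkl, hl⟩ := S.exists_projClass_map_eq H _ _ hc
  refine ⟨l, hik.trans hkl, ?_⟩
  rw [map_sub, sub_eq_zero, K0FullMap_groth, K0FullMap_groth, groth_eq_iff]
  rw [map_add, map_add, projClassMap_comp _ _ _ a, projClassMap_comp _ _ _ b,
    checkMap_comp_checkMap H] at hl
  exact ⟨_, hl⟩

end

theorem coe_K0Map {E F G T : Type*} [Group T] [CommCStarAlgebra E] (S : KSystem T E)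
    [NonUnitalCStarAlgebra F] [ECStarAlgebra E F] [NonUnitalCStarAlgebra G] [ECStarAlgebra E G]
    (φ : F →⋆ₙₐ[E] G) (x : S.K0 F) :
    (S.K0Map φ x : S.K0Full (Unitization E G)) = S.K0FullMap (checkMap φ) x := rfl

/-- Any lift in the full group already lies in the kernel: the augmentation of `F i` factors as the
map to the unitization of `L` followed by the augmentation of `L`. -/
theorem exists_K0Map_eq (H : IsNormColimit (fun i j h => φ i j h) (fun i => ι i)) (x : S.K0 L) :
    ∃ (i : I) (y : S.K0 (F i)), S.K0Map (ι i) y = x := by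
  obtain ⟨i, y, hy⟩ := S.exists_K0FullMap_eq H (x : S.K0Full (Unitization E L))
  refine ⟨i, ⟨y, ?_⟩, Subtype.ext hy⟩
  have h : S.K0FullMap (augmentation E L) x = 0 := x.2
  rw [← hy, K0FullMap_K0FullMap, augmentation_comp_checkMap] at h
  exact h

theorem exists_K0Map_eq_zero (H : IsNormColimit (fun i j h => φ i j h) (fun i => ι i)) {i : I}
    (y : S.K0 (F i)) (hy : S.K0Map (ι i) y = 0) :
    ∃ (j : I) (hij : i ≤ j), S.K0Map (φ i j hij) y = 0 := by
  obtain ⟨j, hij, h⟩ := S.exists_K0FullMap_eq_zero H (y : S.K0Full (Unitization E (F i)))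
    (congrArg Subtype.val hy)
  exact ⟨j, hij, Subtype.ext h⟩

theorem K0Map_comp {E F G D T : Type*} [Group T] [CommCStarAlgebra E] (S : KSystem T E)
    [NonUnitalCStarAlgebra F] [ECStarAlgebra E F] [NonUnitalCStarAlgebra G] [ECStarAlgebra E G]
    [NonUnitalCStarAlgebra D] [ECStarAlgebra E D] (ψ : G →⋆ₙₐ[E] D) (φ : F →⋆ₙₐ[E] G)
    (χ : F →⋆ₙₐ[E] D) (h : ∀ x, ψ (φ x) = χ x) (x : S.K0 F) :
    S.K0Map ψ (S.K0Map φ x) = S.K0Map χ x := by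
  apply Subtype.ext
  rw [coe_K0Map, coe_K0Map, coe_K0Map, K0FullMap_K0FullMap, checkMap_comp ψ φ χ h]

theorem K0Map_id {E F T : Type*} [Group T] [CommCStarAlgebra E] (S : KSystem T E)
    [NonUnitalCStarAlgebra F] [ECStarAlgebra E F] (φ : F →⋆ₙₐ[E] F) (h : ∀ x, φ x = x)
    (x : S.K0 F) : S.K0Map φ x = x := by
  apply Subtype.ext
  rw [coe_K0Map, checkMap_id φ h, K0FullMap_id]

end KSystem

end ProjK

theorem theorem941 {T : Type t} {E : Type w} [Group T] [CommCStarAlgebra E]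
    (S : ProjK.KSystem T E)
    {I : Type v} [Preorder I] [IsDirectedOrder I] [Nonempty I] [DecidableEq I]
    {F : I → Type u} [∀ i, NonUnitalCStarAlgebra (F i)] [∀ i, ProjK.ECStarAlgebra E (F i)]
    (φ : ∀ i j, i ≤ j → F i →⋆ₙₐ[E] F j) [DirectedSystem F fun i j h => φ i j h]
    {L : Type (max u v)} [NonUnitalCStarAlgebra L] [ProjK.ECStarAlgebra E L]
    (ι : ∀ i, F i →⋆ₙₐ[E] L) (hL : ProjK.IsInductiveLimit φ ι) :
    DirectedSystem (fun i => S.K0 (F i)) (fun i j h => S.K0Map (φ i j h)) ∧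
      ∃ ψ : AddCommGroup.DirectLimit (fun i => S.K0 (F i))
          (fun i j h => S.K0Map (φ i j h)) →+ S.K0 L,
        (∀ i, ψ.comp (AddCommGroup.DirectLimit.of (fun i => S.K0 (F i))
          (fun i j h => S.K0Map (φ i j h)) i) = S.K0Map (ι i)) ∧
        (∀ ψ' : AddCommGroup.DirectLimit (fun i => S.K0 (F i))
            (fun i j h => S.K0Map (φ i j h)) →+ S.K0 L,
          (∀ i, ψ'.comp (AddCommGroup.DirectLimit.of (fun i => S.K0 (F i))
            (fun i j h => S.K0Map (φ i j h)) i) = S.K0Map (ι i)) → ψ' = ψ) ∧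
        Function.Bijective ψ := by
  have H := hL.isNormColimit
  have hdir : DirectedSystem (fun i => S.K0 (F i)) (fun i j h => S.K0Map (φ i j h)) :=
    { map_self := fun i x => S.K0Map_id _
        (fun y => DirectedSystem.map_self (f := fun i j h => φ i j h) y) x
      map_map := fun _ _ _ hij hjk x => S.K0Map_comp _ _ _
        (fun y => DirectedSystem.map_map (f := fun i j h => φ i j h) hij hjk y) x }
  let ψ : AddCommGroup.DirectLimit (fun i => S.K0 (F i)) (fun i j h => S.K0Map (φ i j h)) →+
      S.K0 L :=
    AddCommGroup.DirectLimit.lift _ _ _ (fun i => S.K0Map (ι i))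
      (fun i j h x => S.K0Map_comp _ _ _ (H.comp i j h) x)
  have hof : ∀ i (x : S.K0 (F i)), ψ (AddCommGroup.DirectLimit.of (fun i => S.K0 (F i))
      (fun i j h => S.K0Map (φ i j h)) i x) = S.K0Map (ι i) x := fun i x =>
    AddCommGroup.DirectLimit.lift_of (f := fun i j h => S.K0Map (φ i j h)) _ _ _ _ _
  have hψ : ∀ i, ψ.comp (AddCommGroup.DirectLimit.of (fun i => S.K0 (F i))
      (fun i j h => S.K0Map (φ i j h)) i) = S.K0Map (ι i) := fun i => AddMonoidHom.ext (hof i)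
  refine ⟨hdir, ψ, hψ, fun ψ' hψ' => ?_, ?_, fun x => ?_⟩
  · exact AddCommGroup.DirectLimit.hom_ext _ fun i => (hψ' i).trans (hψ i).symm
  -- An element of the direct limit is represented at one index. If its image vanishes, the
  -- representative dies at a later index, hence is zero in the direct limit.
  · rw [injective_iff_map_eq_zero]
    intro z hz
    induction z using AddCommGroup.DirectLimit.induction_on with
    | ih i x =>
      rw [hof] at hz
      obtain ⟨j, hij, h⟩ := S.exists_K0Map_eq_zero H x hz
      rw [← AddCommGroup.DirectLimit.of_f hij, h, map_zero]
  · obtain ⟨i, y, rfl⟩ := S.exists_K0Map_eq H x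
    exact ⟨_, hof i y⟩
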